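/- Let $K$ be a field of characteristic zero, let $m,n\ge 0$ be integers, let $V=K^{m+n}$ with standard basis $e_1,\dots,e_{m+n}$, and let $W\subseteq V$ be the span of $e_1,\dots,e_m$. Let $X$ be the Grassmannian of $m$-planes in $V$, and let $\mathcal O_X(d)$ be the pullback of $\mathcal O(d)$ under the Plücker embedding $W'\mapsto \wedge^m W'$, so that its fibre at an $m$-plane $W'$ is the dual of $(\wedge^m W')^{\otimes d}$. Let $\mathfrak g=\mathfrak{sl}(V)$, the Lie algebra of traceless $(m+n)\times(m+n)$ matrices, act on $H^0(X,\mathcal O_X(d))$ by the differential of the natural action of $\mathrm{SL}(V)$, and on $H^0(X,\mathcal O_X(d))^*$ by the dual action. Let $\mathfrak p\subseteq\mathfrak g$ be the stabiliser of $W$, and let $\mathfrak n\subseteq\mathfrak g$ be the nilradical of the opposite parabolic subalgebra, that is, the subalgebra of the block matrices $\begin{pmatrix}0&0\\ Y&0\end{pmatrix}$ with $Y$ of size $n\times m$. For a Lie algebra $\mathfrak a$ let $U_l(\mathfrak a)\subseteq U(\mathfrak a)$ be the subspace of the enveloping algebra spanned by the products of at most $l$ elements of $\mathfrak a$. Let $v\in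 H^0(X,\mathcal O_X(d))^*$ be a highest weight vector of weight $d(L_1+\dots+L_m)$, where $L_i$ sends a diagonal matrix to its $i$-th diagonal entry: $v\neq0$, $v$ is annihilated by the strictly upper triangular matrices, and every diagonal $H\in\mathfrak g$ acts on $v$ by the scalar $d(L_1+\dots+L_m)(H)$. Put $\mathrm{ann}_l(v)=\{x\in U_l(\mathfrak g): xv=0\}$. Then for all integers $1\le l<d$ there is a direct sum decomposition of vector spaces $$U_l(\mathfrak g)=U_l(\mathfrak n)\oplus \mathrm{ann}_l(v),$$ that is, the map $U_l(\mathfrak n)\times\mathrm{ann}_l(v)\to U_l(\mathfrak g)$, $(x,y)\mapsto \iota(x)+y$, is an isomorphism of $K$-vector spaces, where $\iota:U(\mathfrak n)\to U(\mathfrak g)$ is the canonical homomorphism induced by the inclusion $\mathfrak n\subseteq\mathfrak g$. -/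

import Mathlib

open scoped DualNumber

attribute [local instance 100] LieRing.ofAssociativeRing

universe u

namespace GrassmannianJets

/-! ### Frames of `m`-planes and sections of `O(d)` on the Grassmannian

`V = K ^ (m + n)` with its standard basis, `W` is the span of the first `m` basis vectors, and `X` is
the Grassmannian of `m`-planes in `V`. -/

/-- An `R`-valued frame: an `(m + n) × m` matrix over `R` with a left inverse. Equivalently, its
columns are a basis of a direct summand `W_A` of rank `m` of `R ^ (m + n)`, that is, of an `R`-valued
point of the Grassmannian `X`; Zariski locally every point of `X` has a frame. -/
structure Frame (m n : ℕ) (R : Type u) [CommRing R] where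
  mat : Matrix (Fin (m + n)) (Fin m) R
  exists_leftInverse : ∃ B : Matrix (Fin m) (Fin (m + n)) R, B * mat = 1

namespace Frame

variable {m n : ℕ} {R S : Type u} [CommRing R] [CommRing S]

theorem ext_mat {A B : Frame m n R} (h : A.mat = B.mat) : A = B := by
  cases A; cases B; simp_all

/-- Extension of scalars. -/
def map (φ : R →+* S) (A : Frame m n R) : Frame m n S where
  mat := A.mat.map φ
  exists_leftInverse := by
    obtain ⟨B, hB⟩ := A.exists_leftInverse
    refine ⟨B.map φ, ?_⟩
    rw [← Matrix.map_mul, hB, Matrix.map_one φ (map_zero φ) (map_one φ)]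

/-- The action of `GL_{m+n}` on frames: it moves the plane. -/
def translate (g : (Matrix (Fin (m + n)) (Fin (m + n)) R)ˣ) (A : Frame m n R) : Frame m n R where
  mat := (g : Matrix (Fin (m + n)) (Fin (m + n)) R) * A.mat
  exists_leftInverse := by
    obtain ⟨B, hB⟩ := A.exists_leftInverse
    refine ⟨B * (↑g⁻¹ : Matrix (Fin (m + n)) (Fin (m + n)) R), ?_⟩
    rw [Matrix.mul_assoc, ← Matrix.mul_assoc _ _ A.mat, Units.inv_mul, Matrix.one_mul, hB]

/-- The action of `GL_m` on frames: it changes the basis of the plane. -/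
def changeBasis (A : Frame m n R) (h : (Matrix (Fin m) (Fin m) R)ˣ) : Frame m n R where
  mat := A.mat * (h : Matrix (Fin m) (Fin m) R)
  exists_leftInverse := by
    obtain ⟨B, hB⟩ := A.exists_leftInverse
    refine ⟨(↑h⁻¹ : Matrix (Fin m) (Fin m) R) * B, ?_⟩
    rw [Matrix.mul_assoc, ← Matrix.mul_assoc B, hB, Matrix.one_mul, Units.inv_mul]

theorem map_map {T : Type u} [CommRing T] (φ : R →+* S) (ψ : S →+* T) (A : Frame m n R) :
    (A.map φ).map ψ = A.map (ψ.comp φ) :=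
  ext_mat (by ext; simp [map])

theorem map_changeBasis (φ : R →+* S) (A : Frame m n R) (h : (Matrix (Fin m) (Fin m) R)ˣ) :
    (A.changeBasis h).map φ =
      (A.map φ).changeBasis (Units.map (φ.mapMatrix (m := Fin m)).toMonoidHom h) :=
  ext_mat (by simp [map, changeBasis, Matrix.map_mul])

theorem translate_changeBasis (g : (Matrix (Fin (m + n)) (Fin (m + n)) R)ˣ) (A : Frame m n R)
    (h : (Matrix (Fin m) (Fin m) R)ˣ) :
    (A.changeBasis h).translate g = (A.translate g).changeBasis h :=
  ext_mat (by simp [translate, changeBasis, Matrix.mul_assoc])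

theorem translate_translate (A : Frame m n R)
    (g h : (Matrix (Fin (m + n)) (Fin (m + n)) R)ˣ) :
    (A.translate h).translate g = A.translate (g * h) :=
  ext_mat (by simp [translate, Matrix.mul_assoc])

end Frame

/-- `H⁰(X, O_X(d))`, where `O_X(d)` is the pullback of `O(d)` under the Plücker embedding
`W ↦ ⋀ᵐ W`, described on the functor of points of `X`.

The fibre of `O_X(d)` at an `R`-valued point `W_A` of `X` is the dual of the `d`-th tensor power of
the line `⋀ᵐ W_A ⊆ ⋀ᵐ R ^ (m + n)`. A frame `A = (a₁, …, a_m)` gives the generator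
`a₁ ∧ ⋯ ∧ a_m` of `⋀ᵐ W_A`, and the frame `A h` of the same plane gives `det h` times this generator.
So a global section is a value `s R A ∈ R` (its value on the `d`-th power of that generator) for
each frame `A` over each commutative `K`-algebra `R`, compatible with extension of scalars, such that
`s R (A h) = (det h) ^ d * s R A` for all invertible `h`. -/
def globalSections (K : Type u) [Field K] (m n d : ℕ) :
    Submodule K ((R : CommAlgCat.{u} K) → Frame m n R → R) where
  carrier := {s |
    (∀ (R S : CommAlgCat.{u} K) (φ : R →ₐ[K] S) (A : Frame m n R),
      s S (A.map (φ : R →+* S)) = φ (s R A)) ∧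
    (∀ (R : CommAlgCat.{u} K) (A : Frame m n R) (h : (Matrix (Fin m) (Fin m) R)ˣ),
      s R (A.changeBasis h) = (h : Matrix (Fin m) (Fin m) R).det ^ d * s R A)}
  add_mem' := by
    rintro s t ⟨hs, hs'⟩ ⟨ht, ht'⟩
    exact ⟨fun R S φ A => by simp [hs, ht], fun R A h => by simp [hs', ht', mul_add]⟩
  zero_mem' := ⟨fun R S φ A => by simp, fun R A h => by simp⟩
  smul_mem' := by
    rintro c s ⟨hs, hs'⟩
    exact ⟨fun R S φ A => by simp [hs], fun R A h => by simp [hs']⟩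

section Action

variable {K : Type u} [Field K] {m n d : ℕ}

/-- The invertible matrix `1 - e X`, for `e ^ 2 = 0`; its inverse is `1 + e X`. -/
def infinitesimal {R : Type u} [CommRing R] [Algebra K R] (e : R) (he : e * e = 0)
    (X : Matrix (Fin (m + n)) (Fin (m + n)) K) : (Matrix (Fin (m + n)) (Fin (m + n)) R)ˣ where
  val := 1 - e • X.map (algebraMap K R)
  inv := 1 + e • X.map (algebraMap K R)
  val_inv := by
    rw [sub_mul, mul_add, mul_add, one_mul, one_mul, mul_one, smul_mul_smul_comm, he, zero_smul]
    abel
  inv_val := by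
    rw [add_mul, mul_sub, mul_sub, one_mul, one_mul, mul_one, smul_mul_smul_comm, he, zero_smul]
    abel

/-- The action of `X ∈ gl_{m+n}(K)` on sections, obtained by differentiating
`(g s)(A) = s (g⁻¹ A)` at the identity: `(X s)(A)` is the coefficient of `ε` in
`s ((1 + ε X)⁻¹ A) = s ((1 - ε X) A)`. -/
def infAction (X : Matrix (Fin (m + n)) (Fin (m + n)) K)
    (s : (R : CommAlgCat.{u} K) → Frame m n R → R) :
    (R : CommAlgCat.{u} K) → Frame m n R → R :=
  fun R A => TrivSqZeroExt.snd (s (CommAlgCat.of K R[ε])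
    ((A.map (TrivSqZeroExt.inlAlgHom K R R : R →+* R[ε])).translate
      (infinitesimal (K := K) DualNumber.eps DualNumber.eps_mul_eps X)))

theorem map_translate_infinitesimal {R S : Type u} [CommRing R] [Algebra K R] [CommRing S]
    [Algebra K S] (φ : R →ₐ[K] S) (A : Frame m n R) (e : R) (he : e * e = 0) (e' : S)
    (he' : e' * e' = 0) (h : φ e = e') (X : Matrix (Fin (m + n)) (Fin (m + n)) K) :
    (A.translate (infinitesimal e he X)).map (φ : R →+* S) =
      (A.map (φ : R →+* S)).translate (infinitesimal e' he' X) := by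
  subst h
  apply Frame.ext_mat
  simp only [Frame.map, Frame.translate, infinitesimal, Matrix.map_mul]
  congr 1
  ext i j
  by_cases hij : i = j <;> simp [Matrix.map_apply, hij]

theorem apply_translate_infinitesimal {s : (R : CommAlgCat.{u} K) → Frame m n R → R}
    (hs : s ∈ globalSections K m n d) (R : CommAlgCat.{u} K) (A : Frame m n R) (e : R)
    (he : e * e = 0) (X : Matrix (Fin (m + n)) (Fin (m + n)) K) :
    s R (A.translate (infinitesimal e he X)) = s R A + e * infAction X s R A := by
  let φ : (CommAlgCat.of K R[ε] : Type u) →ₐ[K] R :=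
    DualNumber.lift ⟨(AlgHom.id K R, e), he, fun a => Commute.all _ _⟩
  let B : Frame m n R[ε] :=
    (A.map (TrivSqZeroExt.inlAlgHom K R R : R →+* R[ε])).translate
      (infinitesimal (K := K) DualNumber.eps DualNumber.eps_mul_eps X)
  have h1 : B.map (φ : R[ε] →+* R) = A.translate (infinitesimal e he X) := by
    have := map_translate_infinitesimal (K := K) (S := R) φ
      (A.map (TrivSqZeroExt.inlAlgHom K R R : R →+* R[ε]))
      DualNumber.eps DualNumber.eps_mul_eps e he (by simp [φ]) X
    refine this.trans ?_
    congr 1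
    apply Frame.ext_mat
    ext i j
    simp [Frame.map, φ, DualNumber.lift_apply_apply]
  let π : (CommAlgCat.of K R[ε] : Type u) →ₐ[K] R := TrivSqZeroExt.fstHom K R R
  have h2 : B.map (π : R[ε] →+* R) = A := by
    have := map_translate_infinitesimal (K := K) (S := R) π
      (A.map (TrivSqZeroExt.inlAlgHom K R R : R →+* R[ε]))
      DualNumber.eps DualNumber.eps_mul_eps 0 (by simp) (by simp [π]) X
    refine this.trans ?_
    apply Frame.ext_mat
    ext i j
    simp [Frame.map, Frame.translate, infinitesimal, π]
  have h3 := hs.1 (CommAlgCat.of K R[ε]) R φ B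
  have h4 := hs.1 (CommAlgCat.of K R[ε]) R π B
  rw [h1] at h3
  rw [h2] at h4
  rw [h3, h4]
  change TrivSqZeroExt.fst _ + TrivSqZeroExt.snd _ * e = TrivSqZeroExt.fst _ + e * _
  rw [mul_comm]
  rfl

theorem infAction_mem {s : (R : CommAlgCat.{u} K) → Frame m n R → R}
    (hs : s ∈ globalSections K m n d) (X : Matrix (Fin (m + n)) (Fin (m + n)) K) :
    infAction X s ∈ globalSections K m n d := by
  constructor
  · intro R S φ A
    let ψ : (CommAlgCat.of K R[ε] : Type u) →ₐ[K] (CommAlgCat.of K S[ε] : Type u) :=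
      DualNumber.lift ⟨((TrivSqZeroExt.inlAlgHom K S S).comp φ, DualNumber.eps),
        DualNumber.eps_mul_eps, fun a => Commute.all _ _⟩
    have h := hs.1 _ _ ψ ((A.map (TrivSqZeroExt.inlAlgHom K R R : R →+* R[ε])).translate
      (infinitesimal (K := K) DualNumber.eps DualNumber.eps_mul_eps X))
    have h1 := map_translate_infinitesimal (K := K) (R := R[ε]) (S := S[ε]) ψ
      (A.map (TrivSqZeroExt.inlAlgHom K R R : R →+* R[ε]))
      DualNumber.eps DualNumber.eps_mul_eps DualNumber.eps DualNumber.eps_mul_eps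
      (by simp [ψ]) X
    have h2 : (A.map (TrivSqZeroExt.inlAlgHom K R R : R →+* R[ε])).map (ψ : R[ε] →+* S[ε]) =
        (A.map (φ : R →+* S)).map (TrivSqZeroExt.inlAlgHom K S S : S →+* S[ε]) := by
      apply Frame.ext_mat
      ext i j <;> simp [Frame.map, ψ, DualNumber.lift_apply_apply]
    rw [h2] at h1
    have h3 := (congrArg (s (CommAlgCat.of K S[ε])) h1).symm.trans h
    unfold infAction
    refine (congrArg TrivSqZeroExt.snd h3).trans ?_
    simp [ψ, DualNumber.lift_apply_apply]
  · intro R A h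
    unfold infAction
    rw [Frame.map_changeBasis, Frame.translate_changeBasis]
    have := hs.2 (CommAlgCat.of K R[ε])
      ((A.map (TrivSqZeroExt.inlAlgHom K R R : R →+* R[ε])).translate
        (infinitesimal (K := K) DualNumber.eps DualNumber.eps_mul_eps X))
      (Units.map ((TrivSqZeroExt.inlAlgHom K R R : R →+* R[ε]).mapMatrix
        (m := Fin m)).toMonoidHom h)
    refine (congrArg TrivSqZeroExt.snd this).trans ?_
    have hd : ((Units.map ((TrivSqZeroExt.inlAlgHom K R R : R →+* R[ε]).mapMatrix
        (m := Fin m)).toMonoidHom h : (Matrix (Fin m) (Fin m) R[ε])ˣ) :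
          Matrix (Fin m) (Fin m) R[ε]).det ^ d =
        TrivSqZeroExt.inl ((h : Matrix (Fin m) (Fin m) R).det ^ d) := by
      have h5 := RingHom.map_det (TrivSqZeroExt.inlAlgHom K R R : R →+* R[ε])
        (h : Matrix (Fin m) (Fin m) R)
      refine (congrArg (· ^ d) h5.symm).trans ?_
      simp [TrivSqZeroExt.inl_pow]
    refine (congrArg (fun z => TrivSqZeroExt.snd (z * _)) hd).trans ?_
    simp

theorem apply_map_inl {s : (R : CommAlgCat.{u} K) → Frame m n R → R}
    (hs : s ∈ globalSections K m n d) (R : CommAlgCat.{u} K) (A : Frame m n R) :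
    s (CommAlgCat.of K R[ε]) (A.map (TrivSqZeroExt.inlAlgHom K R R : R →+* R[ε])) =
      (TrivSqZeroExt.inl (s R A) : R[ε]) :=
  hs.1 R (CommAlgCat.of K R[ε]) (TrivSqZeroExt.inlAlgHom K R R) A

theorem infinitesimal_add {R : Type u} [CommRing R] [Algebra K R] (e : R) (he : e * e = 0)
    (X Y : Matrix (Fin (m + n)) (Fin (m + n)) K) :
    infinitesimal e he (X + Y) = infinitesimal e he X * infinitesimal e he Y := by
  ext1
  simp only [infinitesimal, Units.val_mul]
  rw [sub_mul, mul_sub, mul_sub, one_mul, one_mul, mul_one, smul_mul_smul_comm, he, zero_smul,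
    Matrix.map_add _ (map_add _), smul_add]
  abel

theorem infinitesimal_smul {R : Type u} [CommRing R] [Algebra K R] (e : R) (he : e * e = 0)
    (c : K) (he' : (algebraMap K R c * e) * (algebraMap K R c * e) = 0)
    (X : Matrix (Fin (m + n)) (Fin (m + n)) K) :
    infinitesimal e he (c • X) = infinitesimal (algebraMap K R c * e) he' X := by
  ext1
  simp only [infinitesimal]
  congr 1
  ext1 i j
  simp only [Matrix.smul_apply, Matrix.map_apply, smul_eq_mul, map_mul]
  ring

theorem infinitesimal_lie {R : Type u} [CommRing R] [Algebra K R] (e f : R) (he : e * e = 0)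
    (hf : f * f = 0) (hef : (e * f) * (e * f) = 0)
    (X Y : Matrix (Fin (m + n)) (Fin (m + n)) K) :
    infinitesimal f hf Y * infinitesimal e he X =
      infinitesimal (e * f) hef ⁅X, Y⁆ * (infinitesimal e he X * infinitesimal f hf Y) := by
  ext1
  simp only [infinitesimal, Units.val_mul, LieRing.of_associative_ring_bracket,
    Matrix.map_sub _ (map_sub _), Matrix.map_mul]
  generalize X.map (algebraMap K R) = X'
  generalize Y.map (algebraMap K R) = Y'
  have z1 : e * f * e = 0 := by rw [mul_right_comm, he, zero_mul]
  have z2 : e * f * f = 0 := by rw [mul_assoc, hf, mul_zero]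
  simp only [sub_mul, mul_sub, one_mul, mul_one, smul_mul_smul_comm, smul_sub, z1, z2, hef,
    ← mul_assoc, mul_comm f e, zero_smul]
  abel

theorem snd_eps_mul_inl {R : Type u} [CommRing R] (x : R) :
    TrivSqZeroExt.snd ((DualNumber.eps : R[ε]) * TrivSqZeroExt.inl x) = x := by
  simp

theorem infAction_add_left {s : (R : CommAlgCat.{u} K) → Frame m n R → R}
    (hs : s ∈ globalSections K m n d) (X Y : Matrix (Fin (m + n)) (Fin (m + n)) K) :
    infAction (X + Y) s = infAction X s + infAction Y s := by
  have key : ∀ (F : CommAlgCat.{u} K) (A : Frame m n F) (e : F), e * e = 0 →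
      e * infAction (X + Y) s F A = e * infAction X s F A + e * infAction Y s F A := by
    intro F A e he
    have h2 := congrArg (fun g => s F (A.translate g)) (infinitesimal_add e he X Y)
    simp only [← Frame.translate_translate] at h2
    rw [apply_translate_infinitesimal hs, apply_translate_infinitesimal hs,
      apply_translate_infinitesimal hs, apply_translate_infinitesimal (infAction_mem hs X)] at h2
    linear_combination h2 + infAction Y (infAction X s) F A * he
  funext R A
  have h := key (CommAlgCat.of K R[ε])
    (A.map (TrivSqZeroExt.inlAlgHom K R R : R →+* R[ε])) (DualNumber.eps : R[ε])
    DualNumber.eps_mul_eps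
  rw [apply_map_inl (infAction_mem hs _), apply_map_inl (infAction_mem hs _),
    apply_map_inl (infAction_mem hs _)] at h
  have h' := congrArg (TrivSqZeroExt.snd (R := R) (M := R)) h
  rw [TrivSqZeroExt.snd_add] at h'
  exact (snd_eps_mul_inl _).symm.trans (h'.trans
    (congrArg₂ (· + ·) (snd_eps_mul_inl _) (snd_eps_mul_inl _)))

theorem infAction_smul_left {s : (R : CommAlgCat.{u} K) → Frame m n R → R}
    (hs : s ∈ globalSections K m n d) (c : K) (X : Matrix (Fin (m + n)) (Fin (m + n)) K) :
    infAction (c • X) s = c • infAction X s := by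
  have key : ∀ (F : CommAlgCat.{u} K) (A : Frame m n F) (e : F), e * e = 0 →
      e * infAction (c • X) s F A = e * (c • infAction X s) F A := by
    intro F A e he
    have he' : (algebraMap K F c * e) * (algebraMap K F c * e) = 0 := by
      rw [mul_mul_mul_comm, he, mul_zero]
    have h2 := congrArg (fun g => s F (A.translate g)) (infinitesimal_smul e he c he' X)
    beta_reduce at h2
    rw [apply_translate_infinitesimal hs, apply_translate_infinitesimal hs] at h2
    change _ = e * (c • infAction X s F A)
    rw [Algebra.smul_def c (infAction X s F A)]
    linear_combination h2
  funext R A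
  have h := key (CommAlgCat.of K R[ε])
    (A.map (TrivSqZeroExt.inlAlgHom K R R : R →+* R[ε])) (DualNumber.eps : R[ε])
    DualNumber.eps_mul_eps
  rw [apply_map_inl (infAction_mem hs _),
    apply_map_inl (Submodule.smul_mem _ c (infAction_mem hs _))] at h
  have h' := congrArg (TrivSqZeroExt.snd (R := R) (M := R)) h
  exact (snd_eps_mul_inl _).symm.trans (h'.trans (snd_eps_mul_inl _))

theorem infAction_lie {s : (R : CommAlgCat.{u} K) → Frame m n R → R}
    (hs : s ∈ globalSections K m n d) (X Y : Matrix (Fin (m + n)) (Fin (m + n)) K) :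
    infAction X (infAction Y s) = infAction ⁅X, Y⁆ s + infAction Y (infAction X s) := by
  have hX := infAction_mem hs X
  have hY := infAction_mem hs Y
  have hZ := infAction_mem hs ⁅X, Y⁆
  have key : ∀ (F : CommAlgCat.{u} K) (A : Frame m n F) (e f : F), e * e = 0 → f * f = 0 →
      e * (f * infAction X (infAction Y s) F A) =
        e * (f * (infAction ⁅X, Y⁆ s + infAction Y (infAction X s)) F A) := by
    intro F A e f he hf
    have hef : (e * f) * (e * f) = 0 := by rw [mul_mul_mul_comm, he, zero_mul]
    have h2 := congrArg (fun g => s F (A.translate g)) (infinitesimal_lie e f he hf hef X Y)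
    simp only [← Frame.translate_translate] at h2
    rw [apply_translate_infinitesimal hs, apply_translate_infinitesimal hs,
      apply_translate_infinitesimal hs, apply_translate_infinitesimal hs,
      apply_translate_infinitesimal hs,
      apply_translate_infinitesimal hX, apply_translate_infinitesimal hY,
      apply_translate_infinitesimal hZ, apply_translate_infinitesimal hZ] at h2
    rw [Pi.add_apply, Pi.add_apply]
    linear_combination h2 + e * infAction Y (infAction ⁅X, Y⁆ s) F A * hf +
      f * infAction X (infAction ⁅X, Y⁆ s) F (A.translate (infinitesimal f hf Y)) * he
  funext R A
  have hW := Submodule.add_mem _ hZ (infAction_mem hX Y)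
  have h := key (CommAlgCat.of K (CommAlgCat.of K R[ε])[ε])
    ((A.map (TrivSqZeroExt.inlAlgHom K R R : R →+* R[ε])).map
      (TrivSqZeroExt.inlAlgHom K R[ε] R[ε] : R[ε] →+* R[ε][ε]))
    (TrivSqZeroExt.inl (DualNumber.eps : R[ε]) : R[ε][ε]) (DualNumber.eps : R[ε][ε])
    (by
      change (TrivSqZeroExt.inl (DualNumber.eps : R[ε]) : R[ε][ε]) * TrivSqZeroExt.inl _ = 0
      rw [← TrivSqZeroExt.inl_mul, DualNumber.eps_mul_eps, TrivSqZeroExt.inl_zero])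
    DualNumber.eps_mul_eps
  have h3 : ∀ {t : (R : CommAlgCat.{u} K) → Frame m n R → R}, t ∈ globalSections K m n d →
      t (CommAlgCat.of K (CommAlgCat.of K R[ε])[ε])
        ((A.map (TrivSqZeroExt.inlAlgHom K R R : R →+* R[ε])).map
          (TrivSqZeroExt.inlAlgHom K R[ε] R[ε] : R[ε] →+* R[ε][ε])) =
        (TrivSqZeroExt.inl (TrivSqZeroExt.inl (t R A) : R[ε]) : R[ε][ε]) := by
    intro t ht
    have a1 := apply_map_inl ht (CommAlgCat.of K R[ε])
      (A.map (TrivSqZeroExt.inlAlgHom K R R : R →+* R[ε]))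
    exact a1.trans (congrArg TrivSqZeroExt.inl (apply_map_inl ht R A))
  rw [h3 (infAction_mem hY X), h3 hW] at h
  have h4 : ∀ x : R, TrivSqZeroExt.snd (TrivSqZeroExt.snd
      ((TrivSqZeroExt.inl (DualNumber.eps : R[ε]) : R[ε][ε]) *
        ((DualNumber.eps : R[ε][ε]) *
          (TrivSqZeroExt.inl (TrivSqZeroExt.inl x : R[ε]) : R[ε][ε])))) = x := by
    intro x
    simp
  exact (h4 _).symm.trans ((congrArg (fun z : R[ε][ε] =>
    TrivSqZeroExt.snd (TrivSqZeroExt.snd z)) h).trans (h4 _))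

end Action

section Modules

variable (K : Type u) [Field K] (m n d : ℕ)

/-- `𝔤 = sl(V)`: the `(m + n) × (m + n)` matrices of trace zero. -/
abbrev slV : Type u := LieAlgebra.SpecialLinear.sl (Fin (m + n)) K

instance globalSections.instLieRingModule :
    LieRingModule (slV K m n) (globalSections K m n d) where
  bracket X s := ⟨infAction X.1 s.1, infAction_mem s.2 X.1⟩
  add_lie X Y s := Subtype.ext (infAction_add_left s.2 X.1 Y.1)
  lie_add _ _ _ := rfl
  leibniz_lie X Y s := Subtype.ext (infAction_lie s.2 X.1 Y.1)

instance globalSections.instLieModule : LieModule K (slV K m n) (globalSections K m n d) where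
  smul_lie c X s := Subtype.ext (infAction_smul_left s.2 c X.1)
  lie_smul _ _ _ := rfl

/-- The `𝔤`-module `V_λ = H⁰(X, O_X(d))^*`, with the contragredient action `(X v)(s) = -v (X s)`. -/
abbrev dualSections : Type (u + 1) := Module.Dual K (globalSections K m n d)

/-- The abelian subalgebra `𝔫 ⊆ 𝔤` of block matrices `(0 0; Y 0)` with `Y` of size `n × m`: the
nilradical of the parabolic subalgebra opposite to `𝔭 = Lie P`, `P` the stabiliser of `W`. -/
def oppositeNilradical : LieSubalgebra K (slV K m n) where
  carrier := {X | ∀ i j : Fin (m + n), X.1 i j ≠ 0 → m ≤ i.val ∧ j.val < m}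
  add_mem' := by
    intro X Y hX hY i j hij
    by_contra h
    have h1 : X.1 i j = 0 := by by_contra h0; exact h (hX i j h0)
    have h2 : Y.1 i j = 0 := by by_contra h0; exact h (hY i j h0)
    exact hij (by simp [h1, h2])
  zero_mem' := fun i j h => absurd rfl h
  smul_mem' := by
    intro c X hX i j hij
    exact hX i j (by rintro h0; exact hij (by simp [h0]))
  lie_mem' := by
    intro X Y hX hY i j hij
    have aux : ∀ Z T : slV K m n, (∀ i j : Fin (m + n), Z.1 i j ≠ 0 → m ≤ i.val ∧ j.val < m) →
        (∀ i j : Fin (m + n), T.1 i j ≠ 0 → m ≤ i.val ∧ j.val < m) → Z.1 * T.1 = 0 := by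
      intro Z T hZ hT
      ext a b
      rw [Matrix.mul_apply, Matrix.zero_apply]
      refine Finset.sum_eq_zero fun k _ => ?_
      by_contra h0
      have h1 := hZ a k (left_ne_zero_of_mul h0)
      have h2 := hT k b (right_ne_zero_of_mul h0)
      omega
    refine absurd ?_ hij
    rw [LieAlgebra.SpecialLinear.sl_bracket, aux X Y hX hY, aux Y X hY hX]
    simp

variable {K m n d}

/-- `v` is a highest weight vector of weight `λ = d (L₁ + ⋯ + L_m)`, where `L_i` sends a diagonal
matrix to its `i`-th diagonal entry: `v` is nonzero, it is killed by the strictly upper triangular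
matrices, and each diagonal `H ∈ 𝔤` acts on it by the scalar `λ(H)`. -/
structure IsHighestWeightVector (v : dualSections K m n d) : Prop where
  ne_zero : v ≠ 0
  lie_upper : ∀ X : slV K m n, (∀ i j, X.1 i j ≠ 0 → i < j) → ⁅X, v⁆ = 0
  lie_diagonal : ∀ H : slV K m n, (∀ i j, H.1 i j ≠ 0 → i = j) →
    ⁅H, v⁆ = ((d : K) * ∑ i : Fin m, H.1 (Fin.castAdd n i) (Fin.castAdd n i)) • v

end Modules

/-! ### Enveloping algebras -/

section Enveloping

variable (K : Type*) [Field K] (L : Type*) [LieRing L] [LieAlgebra K L]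

/-- The canonical filtration `U_l(L)`: the span of the products of at most `l` elements of `L`. -/
def envFiltration (l : ℕ) : Submodule K (UniversalEnvelopingAlgebra K L) :=
  Submodule.span K {u | ∃ xs : List L, xs.length ≤ l ∧
    u = (xs.map (UniversalEnvelopingAlgebra.ι K)).prod}

variable {L}

/-- The canonical map `U(L') → U(L)` for a Lie subalgebra `L' ⊆ L`. -/
def envInclusion (L' : LieSubalgebra K L) :
    UniversalEnvelopingAlgebra K L' →ₐ[K] UniversalEnvelopingAlgebra K L :=
  UniversalEnvelopingAlgebra.lift K ((UniversalEnvelopingAlgebra.ι K).comp L'.incl)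

variable {M : Type*} [AddCommGroup M] [Module K M] [LieRingModule L M] [LieModule K L M]

/-- The left ideal `ann(v) = {x ∈ U(L) : x v = 0}`, for `v` in an `L`-module. -/
def envAnnihilator (v : M) : Ideal (UniversalEnvelopingAlgebra K L) where
  carrier := {x | UniversalEnvelopingAlgebra.lift K (LieModule.toEnd K L M) x v = 0}
  add_mem' := by
    intro x y hx hy
    change UniversalEnvelopingAlgebra.lift K (LieModule.toEnd K L M) x v = 0 at hx
    change UniversalEnvelopingAlgebra.lift K (LieModule.toEnd K L M) y v = 0 at hy
    change UniversalEnvelopingAlgebra.lift K (LieModule.toEnd K L M) (x + y) v = 0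
    rw [map_add, LinearMap.add_apply, hx, hy, add_zero]
  zero_mem' := by simp
  smul_mem' := by
    intro c x hx
    change UniversalEnvelopingAlgebra.lift K (LieModule.toEnd K L M) x v = 0 at hx
    change UniversalEnvelopingAlgebra.lift K (LieModule.toEnd K L M) (c • x) v = 0
    rw [smul_eq_mul, map_mul, Module.End.mul_apply, hx, map_zero]

/-- `ann_l(v) = ann(v) ∩ U_l(L)`. -/
def annFiltration (v : M) (l : ℕ) : Submodule K (UniversalEnvelopingAlgebra K L) :=
  (envAnnihilator K (L := L) v).restrictScalars K ⊓ envFiltration K L l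

end Enveloping

end GrassmannianJets

/-! On the big cell of planes with a frame `(1 ; Y)`, a section of `O(d)` becomes a polynomial in
the `n * m` entries of `Y`, and it is determined by that polynomial (`restrictCell_injective`).
There each matrix `X` acts as a first-order differential operator (`restrictCell_lie`): the central
element of the Levi subalgebra as the Euler operator up to scale and shift, and `𝔫` by
constant-coefficient derivatives.

Comparing eigenvalues of the central element shows that `v` kills every section vanishing at `Y =
0`. So `v` is a nonzero multiple of evaluation at the origin (`exists_eq_mul_constantCoeff`), the
point `W`, and the stabiliser `𝔭` of `W` acts on `v` by scalars. As `𝔤 = 𝔫 + 𝔭`, moving the factors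
from `𝔭` to the right gives `U_l(𝔤) = U_l(𝔫) + ann_l(v)`.

For directness, `𝔫` is abelian, so `x ∈ U_l(𝔫)` is faithfully given by a polynomial `p` of degree at
most `l`, and `x v` sends a section with polynomial `f` to a nonzero constant times `(p(∂) f)(0)`.
Every monomial of degree at most `d` comes from a section, a product of minors (`monomialSection`).
In characteristic zero these monomials detect all coefficients of `p`, so `x v = 0` forces `x = 0`.
-/

namespace GrassmannianJets

/-! ### The enveloping filtration modulo an annihilator -/

section EnvelopingFiltration

variable {K : Type*} [Field K] {L : Type*} [LieRing L] [LieAlgebra K L]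

theorem prod_mem_envFiltration {l : ℕ} (xs : List L) (h : xs.length ≤ l) :
    (xs.map (UniversalEnvelopingAlgebra.ι K)).prod ∈ envFiltration K L l :=
  Submodule.subset_span ⟨xs, h, rfl⟩

theorem envFiltration_mono {k l : ℕ} (h : k ≤ l) : envFiltration K L k ≤ envFiltration K L l := by
  refine Submodule.span_mono ?_
  rintro _ ⟨xs, hx, rfl⟩
  exact ⟨xs, hx.trans h, rfl⟩

theorem ι_mul_mem_envFiltration (X : L) {l : ℕ} {u : UniversalEnvelopingAlgebra K L}
    (hu : u ∈ envFiltration K L l) :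
    UniversalEnvelopingAlgebra.ι K X * u ∈ envFiltration K L (l + 1) := by
  induction hu using Submodule.span_induction with
  | mem u hu =>
    obtain ⟨xs, hx, rfl⟩ := hu
    simpa using prod_mem_envFiltration (K := K) (X :: xs) (by simpa using hx)
  | zero => simp
  | add u w _ _ hu hw => rw [mul_add]; exact add_mem hu hw
  | smul c u _ hu => rw [mul_smul_comm]; exact Submodule.smul_mem _ c hu

theorem mul_ι_mem_envFiltration (X : L) {l : ℕ} {u : UniversalEnvelopingAlgebra K L}
    (hu : u ∈ envFiltration K L l) :
    u * UniversalEnvelopingAlgebra.ι K X ∈ envFiltration K L (l + 1) := by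
  induction hu using Submodule.span_induction with
  | mem u hu =>
    obtain ⟨xs, hx, rfl⟩ := hu
    simpa using prod_mem_envFiltration (K := K) (xs ++ [X]) (by simpa using hx)
  | zero => simp
  | add u w _ _ hu hw => rw [add_mul]; exact add_mem hu hw
  | smul c u _ hu => rw [smul_mul_assoc]; exact Submodule.smul_mem _ c hu

/-- Leibniz rule: the commutator is a sum of products in which one factor `X` is replaced by `⁅P,
X⁆`, so the number of factors does not grow. -/
theorem commutator_prod_mem_envFiltration (P : L) (xs : List L) :
    UniversalEnvelopingAlgebra.ι K P * (xs.map (UniversalEnvelopingAlgebra.ι K)).prod -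
      (xs.map (UniversalEnvelopingAlgebra.ι K)).prod * UniversalEnvelopingAlgebra.ι K P ∈
      envFiltration K L xs.length := by
  induction xs with
  | nil => simp
  | cons X xs ih =>
    have h : UniversalEnvelopingAlgebra.ι K ⁅P, X⁆ = UniversalEnvelopingAlgebra.ι K P *
        UniversalEnvelopingAlgebra.ι K X - UniversalEnvelopingAlgebra.ι K X *
          UniversalEnvelopingAlgebra.ι K P := by
      rw [LieHom.map_lie, LieRing.of_associative_ring_bracket]
    have h1 := ι_mul_mem_envFiltration X ih
    have h2 := prod_mem_envFiltration (K := K) (⁅P, X⁆ :: xs) le_rfl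
    rw [List.map_cons, List.prod_cons, h] at h2
    rw [List.map_cons, List.prod_cons, List.length_cons]
    convert add_mem h1 h2 using 1
    noncomm_ring

theorem commutator_mem_envFiltration (P : L) {l : ℕ} {u : UniversalEnvelopingAlgebra K L}
    (hu : u ∈ envFiltration K L l) :
    UniversalEnvelopingAlgebra.ι K P * u - u * UniversalEnvelopingAlgebra.ι K P ∈
      envFiltration K L l := by
  induction hu using Submodule.span_induction with
  | mem u hu =>
    obtain ⟨xs, hx, rfl⟩ := hu
    exact envFiltration_mono hx (commutator_prod_mem_envFiltration P xs)
  | zero => simp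
  | add u w _ _ hu hw => convert add_mem hu hw using 1; noncomm_ring
  | smul c u _ hu =>
    rw [mul_smul_comm, smul_mul_assoc, ← smul_sub]; exact Submodule.smul_mem _ c hu

theorem envFiltration_zero_le_iff {S : Submodule K (UniversalEnvelopingAlgebra K L)} :
    envFiltration K L 0 ≤ S ↔ 1 ∈ S := by
  refine ⟨fun h => h (by simpa using prod_mem_envFiltration (K := K) (L := L) [] le_rfl),
    fun h => Submodule.span_le.2 ?_⟩
  rintro _ ⟨xs, hx, rfl⟩
  obtain rfl := List.eq_nil_of_length_eq_zero (Nat.le_zero.1 hx)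
  simpa using h

theorem envFiltration_succ_le {l : ℕ} {S : Submodule K (UniversalEnvelopingAlgebra K L)}
    (h1 : 1 ∈ S) (h : ∀ (X : L), ∀ u ∈ envFiltration K L l,
      UniversalEnvelopingAlgebra.ι K X * u ∈ S) : envFiltration K L (l + 1) ≤ S := by
  refine Submodule.span_le.2 ?_
  rintro _ ⟨xs, hx, rfl⟩
  cases xs with
  | nil => simpa using h1
  | cons X xs =>
    simpa using h X _ (prod_mem_envFiltration (K := K) xs (by simpa using hx))

theorem envInclusion_ι (L' : LieSubalgebra K L) (Y : L') :
    envInclusion K L' (UniversalEnvelopingAlgebra.ι K Y) =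
      UniversalEnvelopingAlgebra.ι K (Y : L) := by
  simp [envInclusion]

theorem map_envInclusion_le (L' : LieSubalgebra K L) (l : ℕ) :
    (envFiltration K L' l).map (envInclusion K L').toLinearMap ≤ envFiltration K L l := by
  rw [Submodule.map_le_iff_le_comap]
  refine Submodule.span_le.2 ?_
  rintro _ ⟨xs, hx, rfl⟩
  have := prod_mem_envFiltration (K := K) (xs.map (Subtype.val : L' → L)) (l := l) (by simpa)
  have h : (envInclusion K L') ∘ UniversalEnvelopingAlgebra.ι K =
      UniversalEnvelopingAlgebra.ι K ∘ (Subtype.val : L' → L) := funext (envInclusion_ι L')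
  rw [List.map_map, ← h, ← List.map_map, ← map_list_prod] at this
  exact this

variable {M : Type*} [AddCommGroup M] [Module K M] [LieRingModule L M] [LieModule K L M]

theorem mem_annFiltration {v : M} {l : ℕ} {u : UniversalEnvelopingAlgebra K L} :
    u ∈ annFiltration K v l ↔
      UniversalEnvelopingAlgebra.lift K (LieModule.toEnd K L M) u v = 0 ∧
        u ∈ envFiltration K L l := Iff.rfl

/-- If `L = L' + P` where each element of `P` acts on `v` by a scalar, then
`U_l(L) = U_l(L') + ann_l(v)`. -/
theorem envFiltration_le_map_sup_annFiltration (L' : LieSubalgebra K L) (v : M)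
    (h : ∀ X : L, ∃ Y ∈ L', ∃ P : L, X = Y + P ∧ ∃ c : K, ⁅P, v⁆ = c • v) (l : ℕ) :
    envFiltration K L l ≤
      (envFiltration K L' l).map (envInclusion K L').toLinearMap ⊔ annFiltration K v l := by
  have one_mem (l : ℕ) : (1 : UniversalEnvelopingAlgebra K L) ∈
      (envFiltration K L' l).map (envInclusion K L').toLinearMap ⊔ annFiltration K v l :=
    Submodule.mem_sup_left
      ⟨1, by simpa using prod_mem_envFiltration (K := K) (L := L') (l := l) [] (by simp), by simp⟩
  induction l with
  | zero => exact envFiltration_zero_le_iff.2 (one_mem 0)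
  | succ l ih =>
    have mono : (envFiltration K L' l).map (envInclusion K L').toLinearMap ⊔ annFiltration K v l ≤
        (envFiltration K L' (l + 1)).map (envInclusion K L').toLinearMap ⊔
          annFiltration K v (l + 1) :=
      sup_le_sup (Submodule.map_mono (envFiltration_mono l.le_succ))
        (inf_le_inf_left _ (envFiltration_mono l.le_succ))
    refine envFiltration_succ_le (one_mem _) fun X u hu => ?_
    obtain ⟨_, ⟨w, hw, rfl⟩, a, ha, rfl⟩ := Submodule.mem_sup.1 (ih hu)
    obtain ⟨Y, hY, P, rfl, c, hc⟩ := h X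
    rw [mem_annFiltration] at ha
    have hw' : envInclusion K L' w ∈ envFiltration K L l :=
      map_envInclusion_le L' l (Submodule.mem_map_of_mem hw)
    -- With `w` also denoting its image in `U(L)`, `(Y + P) (w + a) = (Y + P) a + Y w + [P, w] + (w
    -- P - c w) + c w`. The first and fourth terms kill `v`, the second and last come from `U(L')`,
    -- and `[P, w]` stays in `U_l(L)`, so the induction hypothesis applies to it as well.
    have h1 : UniversalEnvelopingAlgebra.ι K (Y + P) * a ∈ annFiltration K v (l + 1) :=
      mem_annFiltration.2 ⟨by rw [map_mul, Module.End.mul_apply, ha.1, map_zero],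
        ι_mul_mem_envFiltration _ ha.2⟩
    have h2 : UniversalEnvelopingAlgebra.ι K Y * envInclusion K L' w ∈
        (envFiltration K L' (l + 1)).map (envInclusion K L').toLinearMap :=
      ⟨UniversalEnvelopingAlgebra.ι K ⟨Y, hY⟩ * w, ι_mul_mem_envFiltration _ hw, by
        rw [AlgHom.coe_toLinearMap, map_mul, envInclusion_ι]⟩
    have h3 := mono (ih (commutator_mem_envFiltration P hw'))
    have h4 : envInclusion K L' w * UniversalEnvelopingAlgebra.ι K P - c • envInclusion K L' w ∈
        annFiltration K v (l + 1) := by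
      refine mem_annFiltration.2 ⟨?_, sub_mem (mul_ι_mem_envFiltration P hw')
        (Submodule.smul_mem _ c (envFiltration_mono l.le_succ hw'))⟩
      simp [hc]
    have h5 : c • envInclusion K L' w ∈
        (envFiltration K L' (l + 1)).map (envInclusion K L').toLinearMap :=
      Submodule.smul_mem _ c (Submodule.mem_map_of_mem (envFiltration_mono l.le_succ hw))
    convert add_mem (add_mem (Submodule.mem_sup_right h1) (Submodule.mem_sup_left h2))
      (add_mem h3 (add_mem (Submodule.mem_sup_right h4) (Submodule.mem_sup_left h5))) using 1
    simp only [AlgHom.coe_toLinearMap, map_add]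
    noncomm_ring

/-- If `U_l(L) = U_l(L') + ann_l(v)` and no nonzero element of `U_l(L')` kills `v`, the sum is
direct. -/
theorem exists_linearEquiv_envFiltration (L' : LieSubalgebra K L) (v : M) (l : ℕ)
    (hsup : envFiltration K L l ≤
      (envFiltration K L' l).map (envInclusion K L').toLinearMap ⊔ annFiltration K v l)
    (hinj : ∀ x ∈ envFiltration K L' l,
      UniversalEnvelopingAlgebra.lift K (LieModule.toEnd K L M) (envInclusion K L' x) v = 0 →
        x = 0) :
    ∃ e : (envFiltration K L' l × annFiltration K (L := L) v l) ≃ₗ[K] envFiltration K L l,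
      ∀ x y, (e (x, y) : UniversalEnvelopingAlgebra K L) =
        envInclusion K L' (x : UniversalEnvelopingAlgebra K L') +
          (y : UniversalEnvelopingAlgebra K L) := by
  let f : (envFiltration K L' l × annFiltration K (L := L) v l) →ₗ[K] envFiltration K L l :=
    LinearMap.codRestrict _
      (((envInclusion K L').toLinearMap.comp (Submodule.subtype _)).coprod (Submodule.subtype _))
      fun z => add_mem (map_envInclusion_le L' l (Submodule.mem_map_of_mem z.1.2)) z.2.2.2
  refine ⟨LinearEquiv.ofBijective f ⟨?_, ?_⟩, fun x y => rfl⟩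
  · rw [injective_iff_map_eq_zero]
    rintro ⟨x, y⟩ hxy
    have h0 : envInclusion K L' (x : UniversalEnvelopingAlgebra K L') +
        (y : UniversalEnvelopingAlgebra K L) = 0 := congrArg Subtype.val hxy
    have hx : x = 0 := by
      refine Subtype.ext (hinj x x.2 ?_)
      rw [eq_neg_of_add_eq_zero_left h0, map_neg, LinearMap.neg_apply, (mem_annFiltration.1 y.2).1,
        neg_zero]
    subst hx
    simpa using h0
  · rintro ⟨u, hu⟩
    obtain ⟨_, ⟨w, hw, rfl⟩, a, ha, rfl⟩ := Submodule.mem_sup.1 (hsup hu)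
    exact ⟨(⟨w, hw⟩, ⟨a, ha⟩), rfl⟩

end EnvelopingFiltration

/-! ### The big cell -/

section BigCell

variable {m n d : ℕ}

namespace Frame

variable {R S : Type u} [CommRing R] [CommRing S]

/-- The frame `(1 ; Y)` of a point of the big cell. -/
def cell (Y : Matrix (Fin n) (Fin m) R) : Frame m n R where
  mat := Matrix.of fun i j =>
    Fin.addCases (fun a => (1 : Matrix (Fin m) (Fin m) R) a j) (fun b => Y b j) i
  exists_leftInverse := by
    refine ⟨Matrix.of fun i => Fin.append ((1 : Matrix (Fin m) (Fin m) R) i) 0, ?_⟩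
    ext i j
    simp [Matrix.mul_apply, Fin.sum_univ_add, Matrix.one_apply]

@[simp]
theorem cell_mat_castAdd (Y : Matrix (Fin n) (Fin m) R) (i j : Fin m) :
    (cell Y).mat (Fin.castAdd n i) j = (1 : Matrix (Fin m) (Fin m) R) i j := by
  simp [cell]

@[simp]
theorem cell_mat_natAdd (Y : Matrix (Fin n) (Fin m) R) (i : Fin n) (j : Fin m) :
    (cell Y).mat (Fin.natAdd m i) j = Y i j := by
  simp [cell]

/-- The top `m × m` block of a frame. -/
def top (A : Frame m n R) : Matrix (Fin m) (Fin m) R := A.mat.submatrix (Fin.castAdd n) id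

/-- The bottom `n × m` block of a frame. -/
def bot (A : Frame m n R) : Matrix (Fin n) (Fin m) R := A.mat.submatrix (Fin.natAdd m) id

theorem ext_top_bot {A B : Frame m n R} (h : A.top = B.top) (h' : A.bot = B.bot) : A = B := by
  refine ext_mat ?_
  ext i j
  induction i using Fin.addCases with
  | left i => exact congrFun₂ h i j
  | right i => exact congrFun₂ h' i j

@[simp]
theorem top_cell (Y : Matrix (Fin n) (Fin m) R) : (cell Y).top = 1 := by
  ext; simp [top]

@[simp]
theorem bot_cell (Y : Matrix (Fin n) (Fin m) R) : (cell Y).bot = Y := by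
  ext; simp [bot]

@[simp]
theorem top_changeBasis (A : Frame m n R) (h : (Matrix (Fin m) (Fin m) R)ˣ) :
    (A.changeBasis h).top = A.top * (h : Matrix (Fin m) (Fin m) R) := rfl

@[simp]
theorem bot_changeBasis (A : Frame m n R) (h : (Matrix (Fin m) (Fin m) R)ˣ) :
    (A.changeBasis h).bot = A.bot * (h : Matrix (Fin m) (Fin m) R) := rfl

@[simp]
theorem top_map (A : Frame m n R) (φ : R →+* S) : (A.map φ).top = A.top.map φ := rfl

@[simp]
theorem bot_map (A : Frame m n R) (φ : R →+* S) : (A.map φ).bot = A.bot.map φ := rfl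

theorem cell_map (Y : Matrix (Fin n) (Fin m) R) (φ : R →+* S) :
    (cell Y).map φ = cell (Y.map φ) := by
  apply ext_top_bot <;> simp [Matrix.map_one]

theorem eq_cell_changeBasis (A : Frame m n R) (h : (Matrix (Fin m) (Fin m) R)ˣ)
    (hA : A.top = h) (Y : Matrix (Fin n) (Fin m) R)
    (hY : Y * (h : Matrix (Fin m) (Fin m) R) = A.bot) : A = (cell Y).changeBasis h := by
  apply ext_top_bot <;> simp [hA, hY]

end Frame

variable {K : Type u} [Field K]

variable (m n K) in
/-- The coordinate ring of the big cell. -/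
abbrev CellRing : Type u := MvPolynomial (Fin n × Fin m) K

/-- The universal point of the big cell. -/
noncomputable def univMatrix : Matrix (Fin n) (Fin m) (CellRing m n K) :=
  Matrix.of fun i j => MvPolynomial.X (i, j)

/-- Restriction of sections to the big cell, trivialised by the frame `(1 ; Y)`. -/
noncomputable def restrictCell : globalSections K m n d →ₗ[K] CellRing m n K where
  toFun s := s.1 (CommAlgCat.of K (CellRing m n K)) (Frame.cell univMatrix)
  map_add' _ _ := rfl
  map_smul' _ _ := rfl

/-- Functoriality: every `Y` is the image of `univMatrix` under the algebra map that evaluates the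
variables at its entries. -/
theorem apply_cell (s : globalSections K m n d) (R : CommAlgCat.{u} K)
    (Y : Matrix (Fin n) (Fin m) R) :
    s.1 R (Frame.cell Y) = MvPolynomial.aeval (fun p => Y p.1 p.2) (restrictCell s) := by
  refine Eq.trans ?_ (s.2.1 (CommAlgCat.of K (CellRing m n K)) R
    (MvPolynomial.aeval (fun p => Y p.1 p.2)) (Frame.cell univMatrix))
  rw [Frame.cell_map]
  refine congrArg (fun Z => s.1 R (Frame.cell Z)) (Matrix.ext fun i j => ?_)
  simp [univMatrix]

theorem apply_of_top_eq (s : globalSections K m n d) (R : CommAlgCat.{u} K) (A : Frame m n R)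
    (h : (Matrix (Fin m) (Fin m) R)ˣ) (hA : A.top = h) (Y : Matrix (Fin n) (Fin m) R)
    (hY : Y * (h : Matrix (Fin m) (Fin m) R) = A.bot) :
    s.1 R A = (h : Matrix (Fin m) (Fin m) R).det ^ d *
      MvPolynomial.aeval (fun p => Y p.1 p.2) (restrictCell s) := by
  rw [A.eq_cell_changeBasis h hA Y hY, s.2.2, apply_cell]

theorem apply_eq_zero_of_isUnit_det {s : globalSections K m n d} (hs : restrictCell s = 0)
    (R : CommAlgCat.{u} K) (A : Frame m n R) (hA : IsUnit A.top.det) : s.1 R A = 0 := by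
  obtain ⟨h, hh⟩ := (Matrix.isUnit_iff_isUnit_det _).2 hA
  rw [apply_of_top_eq s R A h hh.symm (A.bot * (↑h⁻¹ : Matrix (Fin m) (Fin m) R)) (by
    rw [Matrix.mul_assoc, Units.inv_mul, Matrix.mul_one]), hs, map_zero, mul_zero]

open Polynomial in
/-- Sections of `O(d)` are determined by their restriction to the big cell. -/
theorem restrictCell_injective :
    Function.Injective (restrictCell : globalSections K m n d →ₗ[K] CellRing m n K) := by
  rw [injective_iff_map_eq_zero]
  intro s hs
  refine Subtype.ext (funext fun R => funext fun A => ?_)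
  change s.1 R A = 0
  -- The big cell is dense in a sense valid over any ring `R`: `A` deforms to a frame whose top
  -- minor is a monic polynomial in `t`, hence not a zero divisor. The section vanishes once this
  -- minor is inverted, hence on the deformed frame, hence at `t = 0`.
  obtain ⟨B, hB⟩ := A.exists_leftInverse
  -- the deformation `A + t (1 ; 0)` of `A`, over `R[t]` with `q = det (1 + t B (1 ; 0))` inverted
  let J : Frame m n R := Frame.cell 0
  let At : Matrix (Fin (m + n)) (Fin m) R[X] := A.mat.map C + (X : R[X]) • J.mat.map C
  let Q : Matrix (Fin m) (Fin m) R[X] := B.map C * At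
  have hQ : Q.map (eval 0) = 1 := by
    have : (B.map C).map (eval 0) * At.map (eval 0) = 1 := by
      rw [← hB]; congr 1 <;> ext i j <;> simp [At]
    rw [← this]
    exact Matrix.map_mul (f := evalRingHom (0 : R))
  have hq : eval 0 Q.det = 1 := by
    have := RingHom.map_det (evalRingHom (0 : R)) Q
    rw [coe_evalRingHom] at this
    rw [this]
    refine (congrArg Matrix.det hQ).trans Matrix.det_one
  -- Inverting `Q.det` gives `At` a left inverse, and since `Q.det` is `1` at `t = 0`,
  -- specialisation to `t = 0` still makes sense on `S`.
  let S := Localization.Away Q.det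
  have hQS : IsUnit (Q.map (algebraMap R[X] S)) := by
    rw [Matrix.isUnit_iff_isUnit_det]
    have := RingHom.map_det (algebraMap R[X] S) Q
    refine (congrArg IsUnit this).mp (IsLocalization.Away.algebraMap_isUnit _)
  obtain ⟨g, hg⟩ := hQS
  let F : Frame m n S := ⟨At.map (algebraMap R[X] S),
    (↑g⁻¹ : Matrix (Fin m) (Fin m) S) * (B.map C).map (algebraMap R[X] S), by
      rw [Matrix.mul_assoc, ← Matrix.map_mul]
      exact (congrArg ((↑g⁻¹ : Matrix (Fin m) (Fin m) S) * ·) hg.symm).trans g.inv_mul⟩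
  -- specialisation at `t = 0`
  have hu : IsUnit (evalRingHom (0 : R) Q.det) := by
    rw [coe_evalRingHom, hq]; exact isUnit_one
  let ev : S →ₐ[K] R :=
    { IsLocalization.Away.lift (S := S) (g := evalRingHom (0 : R)) Q.det hu with
      commutes' := fun c => by
        simp [IsScalarTower.algebraMap_apply K R[X] S] }
  have hev (x : R[X]) : ev (algebraMap R[X] S x) = eval 0 x :=
    IsLocalization.Away.lift_eq (S := S) (g := evalRingHom (0 : R)) Q.det hu x
  have hF : F.map (ev : S →+* R) = A := by
    refine Frame.ext_mat ?_
    ext i j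
    change ev (algebraMap R[X] S (At i j)) = _
    rw [hev]
    simp [At]
  -- the top minor is monic
  let c : R[X] := (-A.top).charpoly
  have hc : c.Monic := Matrix.charpoly_monic _
  -- The top block of `At` is `t + A.top`, the characteristic matrix of `-A.top`.
  have hcF : F.top.det = algebraMap R[X] S c := by
    refine Eq.trans ?_ (RingHom.map_det (algebraMap R[X] S) _).symm
    congr 1
    ext i j
    change algebraMap R[X] S (At (Fin.castAdd n i) j) = algebraMap R[X] S (Matrix.charmatrix _ i j)
    congr 1
    by_cases hij : i = j
    · subst hij; simp [At, J, Frame.top, Matrix.charmatrix_apply_eq, add_comm]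
    · simp [At, J, Frame.top, hij]
  have hcS : c ∈ nonZeroDivisors R[X] := hc.mem_nonZeroDivisors
  let T := Localization.Away (algebraMap R[X] S c)
  have hinj : Function.Injective (algebraMap S T) := by
    refine IsLocalization.injective (M := Submonoid.powers (algebraMap R[X] S c)) T ?_
    rw [Submonoid.powers_le]
    exact IsLocalization.map_nonZeroDivisors_le (Submonoid.powers Q.det) S ⟨c, hcS, rfl⟩
  have h0 : s.1 (CommAlgCat.of K S) F = 0 := by
    refine hinj ?_
    rw [map_zero]
    have := s.2.1 (CommAlgCat.of K S) (CommAlgCat.of K T) (IsScalarTower.toAlgHom K S T) F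
    refine this.symm.trans (apply_eq_zero_of_isUnit_det hs _ _ ?_)
    have := RingHom.map_det (algebraMap S T) F.top
    rw [hcF] at this
    exact (congrArg IsUnit this).mp (IsLocalization.Away.algebraMap_isUnit _)
  have := s.2.1 (CommAlgCat.of K S) R ev F
  rw [hF, h0, map_zero] at this
  exact this

end BigCell

/-! ### The action of `sl(V)` on the big cell -/

section CellAction

/-- First-order Taylor expansion of `f (X + ε Z)`, with `ε ^ 2 = 0`. -/
theorem aeval_inl_add_eps_smul {K : Type u} [Field K] {σ : Type*} [Fintype σ]
    (Z : σ → MvPolynomial σ K) (f : MvPolynomial σ K) :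
    MvPolynomial.aeval (R := K) (S₁ := (MvPolynomial σ K)[ε])
        (fun i => TrivSqZeroExt.inl (MvPolynomial.X i) + TrivSqZeroExt.inr (Z i)) f =
      TrivSqZeroExt.inl f + TrivSqZeroExt.inr (∑ i, Z i * MvPolynomial.pderiv i f) := by
  induction f using MvPolynomial.induction_on with
  | C a =>
    simp only [MvPolynomial.algHom_C, MvPolynomial.pderiv_C, mul_zero, Finset.sum_const_zero,
      TrivSqZeroExt.inr_zero, add_zero]
    rfl
  | add p q hp hq =>
    simp only [map_add, hp, hq, mul_add, Finset.sum_add_distrib, TrivSqZeroExt.inl_add,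
      TrivSqZeroExt.inr_add]
    abel
  | mul_X p i hp =>
    classical
    rw [map_mul, hp, MvPolynomial.aeval_X]
    have : ∑ j, Z j * MvPolynomial.pderiv j (p * MvPolynomial.X i) =
        p * Z i + MvPolynomial.X i * ∑ j, Z j * MvPolynomial.pderiv j p := by
      simp only [Derivation.leibniz, MvPolynomial.pderiv_X, smul_eq_mul, mul_add,
        Finset.sum_add_distrib, Finset.mul_sum]
      congr 1
      · simp [Pi.single_apply, mul_comm]
      · exact Finset.sum_congr rfl fun j _ => by ring
    rw [this]
    ext <;> simp [mul_comm, add_comm]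

theorem snd_one_sub_inr_mul {R : Type u} [CommRing R] (a f g : R) :
    TrivSqZeroExt.snd ((TrivSqZeroExt.inl 1 - TrivSqZeroExt.inr a : R[ε]) *
      (TrivSqZeroExt.inl f + TrivSqZeroExt.inr g)) = g - a * f := by
  simp [mul_comm, sub_eq_add_neg]

theorem det_one_sub_eps_pow {R : Type u} [CommRing R] {m : ℕ} (M : Matrix (Fin m) (Fin m) R)
    (d : ℕ) :
    ((1 : Matrix (Fin m) (Fin m) R[ε]) - (DualNumber.eps : R[ε]) •
        M.map (TrivSqZeroExt.inlHom R R)).det ^ d =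
      TrivSqZeroExt.inl 1 - TrivSqZeroExt.inr (d * M.trace) := by
  have h1 : ((1 : Matrix (Fin m) (Fin m) R[ε]) - (DualNumber.eps : R[ε]) •
        M.map (TrivSqZeroExt.inlHom R R)).det =
      TrivSqZeroExt.inl 1 - TrivSqZeroExt.inr M.trace := by
    rw [sub_eq_add_neg, ← neg_smul, Matrix.det_one_add_smul]
    have h2 : (M.map (TrivSqZeroExt.inlHom R R)).trace = TrivSqZeroExt.inl M.trace :=
      (AddMonoidHom.map_trace (TrivSqZeroExt.inlHom R R).toAddMonoidHom M).symm
    have h3 : (-DualNumber.eps : R[ε]) ^ 2 = 0 := by simp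
    rw [h2, h3]
    ext <;> simp
  rw [h1]
  ext <;> simp

variable {K : Type u} [Field K] {m n d : ℕ}

/-- The infinitesimal change of frame on the big cell given by `X = (P Q; R S)`, up to sign. -/
noncomputable def cellGauge (X : Matrix (Fin (m + n)) (Fin (m + n)) K) :
    Matrix (Fin m) (Fin m) (CellRing m n K) :=
  let X' := X.map (algebraMap K (CellRing m n K))
  let Y : Matrix (Fin n) (Fin m) (CellRing m n K) := univMatrix
  X'.submatrix (Fin.castAdd n) (Fin.castAdd n) + X'.submatrix (Fin.castAdd n) (Fin.natAdd m) * Y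

/-- The vector field on the big cell given by `X = (P Q; R S)`, up to sign. -/
noncomputable def cellField (X : Matrix (Fin (m + n)) (Fin (m + n)) K) :
    Matrix (Fin n) (Fin m) (CellRing m n K) :=
  let X' := X.map (algebraMap K (CellRing m n K))
  let Y : Matrix (Fin n) (Fin m) (CellRing m n K) := univMatrix
  Y * cellGauge X - (X'.submatrix (Fin.natAdd m) (Fin.castAdd n) +
      X'.submatrix (Fin.natAdd m) (Fin.natAdd m) * Y)

theorem Frame.top_translate {R : Type u} [CommRing R]
    (g : (Matrix (Fin (m + n)) (Fin (m + n)) R)ˣ) (A : Frame m n R) :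
    (A.translate g).top = (g : Matrix (Fin (m + n)) (Fin (m + n)) R).submatrix (Fin.castAdd n) (Fin.castAdd n) * A.top +
      (g : Matrix (Fin (m + n)) (Fin (m + n)) R).submatrix (Fin.castAdd n) (Fin.natAdd m) * A.bot := by
  ext i j
  simp [Frame.translate, Frame.top, Frame.bot, Matrix.mul_apply, Fin.sum_univ_add]

theorem Frame.bot_translate {R : Type u} [CommRing R]
    (g : (Matrix (Fin (m + n)) (Fin (m + n)) R)ˣ) (A : Frame m n R) :
    (A.translate g).bot = (g : Matrix (Fin (m + n)) (Fin (m + n)) R).submatrix (Fin.natAdd m) (Fin.castAdd n) * A.top +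
      (g : Matrix (Fin (m + n)) (Fin (m + n)) R).submatrix (Fin.natAdd m) (Fin.natAdd m) * A.bot := by
  ext i j
  simp [Frame.translate, Frame.top, Frame.bot, Matrix.mul_apply, Fin.sum_univ_add]

/-- For `N = (P Q; R S)` and `G = P + Q Y`, the translate is `(1 - e G ; Y - e (R + S Y))`.
Normalising its top block multiplies on the right by `(1 - e G)⁻¹ = 1 + e G`, which adds `e Y G` to
the bottom block because `e ^ 2 = 0`. -/
theorem Frame.cell_translate {R : Type u} [CommRing R] (e : R) (he : e * e = 0)
    (N : Matrix (Fin (m + n)) (Fin (m + n)) R) (g : (Matrix (Fin (m + n)) (Fin (m + n)) R)ˣ)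
    (hg : (g : Matrix (Fin (m + n)) (Fin (m + n)) R) = 1 - e • N)
    (Y : Matrix (Fin n) (Fin m) R) (G : Matrix (Fin m) (Fin m) R)
    (hG : G = N.submatrix (Fin.castAdd n) (Fin.castAdd n) +
      N.submatrix (Fin.castAdd n) (Fin.natAdd m) * Y)
    (h : (Matrix (Fin m) (Fin m) R)ˣ) (hh : (h : Matrix (Fin m) (Fin m) R) = 1 - e • G) :
    (Frame.cell Y).translate g = (Frame.cell (Y + e • (Y * G -
      (N.submatrix (Fin.natAdd m) (Fin.castAdd n) +
        N.submatrix (Fin.natAdd m) (Fin.natAdd m) * Y)))).changeBasis h := by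
  have h12 : (1 : Matrix (Fin (m + n)) (Fin (m + n)) R).submatrix
      (Fin.castAdd n) (Fin.natAdd m) = 0 := by
    ext1 a b
    simp [Matrix.one_apply, Fin.ext_iff]
    omega
  have h21 : (1 : Matrix (Fin (m + n)) (Fin (m + n)) R).submatrix
      (Fin.natAdd m) (Fin.castAdd n) = 0 := by
    ext1 a b
    simp [Matrix.one_apply, Fin.ext_iff]
    omega
  apply Frame.ext_top_bot
  · rw [Frame.top_translate, Frame.top_changeBasis, hg, hh, hG, Frame.top_cell, Frame.bot_cell,
      Frame.top_cell]
    simp only [Matrix.submatrix_sub, Matrix.submatrix_smul, Pi.sub_apply, Pi.smul_apply, h12,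
      Matrix.submatrix_one _ (Fin.castAdd_injective m n)]
    rw [zero_sub, Matrix.neg_mul, Matrix.mul_one, smul_add, Matrix.smul_mul, Matrix.one_mul]
    abel
  · rw [Frame.bot_translate, Frame.bot_changeBasis, hg, hh, Frame.top_cell, Frame.bot_cell,
      Frame.bot_cell]
    simp only [Matrix.submatrix_sub, Matrix.submatrix_smul, Pi.sub_apply, Pi.smul_apply, h21,
      Matrix.submatrix_one _ (Fin.natAdd_injective n m)]
    simp only [Matrix.smul_mul, Matrix.mul_smul, smul_sub, smul_add, smul_smul, he, zero_smul,
      Matrix.mul_one, Matrix.one_mul, zero_sub, Matrix.add_mul, Matrix.mul_sub, Matrix.sub_mul]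
    abel

/-- Apply `Frame.cell_translate` to the universal point with `e = ε` and take the coefficient of
`ε`: moving the point gives the vector field, and the factor `det ^ d` from renormalising the frame
gives the trace term. -/
theorem restrictCell_lie (X : slV K m n) (s : globalSections K m n d) :
    restrictCell ⁅X, s⁆ =
      ∑ p, cellField X.1 p.1 p.2 * MvPolynomial.pderiv p (restrictCell s) -
        d * (cellGauge X.1).trace * restrictCell s := by
  let R := CellRing m n K
  let i : R →+* R[ε] := TrivSqZeroExt.inlHom R R
  let e : R[ε] := DualNumber.eps
  have he : e * e = 0 := DualNumber.eps_mul_eps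
  let G := (cellGauge X.1).map i
  let Y := (univMatrix : Matrix (Fin n) (Fin m) R).map i
  let N := (X.1).map (algebraMap K R[ε])
  have hG : G = N.submatrix (Fin.castAdd n) (Fin.castAdd n) +
      N.submatrix (Fin.castAdd n) (Fin.natAdd m) * Y := by
    simp only [G, Y, cellGauge]
    rw [Matrix.map_add _ (map_add i), Matrix.map_mul]
    rfl
  have hZ : (cellField X.1).map i = Y * G - (N.submatrix (Fin.natAdd m) (Fin.castAdd n) +
      N.submatrix (Fin.natAdd m) (Fin.natAdd m) * Y) := by
    simp only [G, Y, cellField]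
    rw [Matrix.map_sub _ (map_sub i), Matrix.map_add _ (map_add i), Matrix.map_mul, Matrix.map_mul]
    rfl
  have hGG : (e • G) * (e • G) = 0 := by
    rw [smul_mul_smul_comm, he, zero_smul]
  let h : (Matrix (Fin m) (Fin m) R[ε])ˣ := ⟨1 - e • G, 1 + e • G, by
    rw [sub_mul, mul_add, mul_add, hGG]; simp, by rw [add_mul, mul_sub, mul_sub, hGG]; simp⟩
  have hF := Frame.cell_translate e he N (infinitesimal (K := K) e he X.1) rfl Y G hG h rfl
  rw [← hZ] at hF
  have hY : Y + e • (cellField X.1).map i = Matrix.of fun a b =>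
      TrivSqZeroExt.inl (MvPolynomial.X (a, b)) + TrivSqZeroExt.inr (cellField X.1 a b) := by
    refine Matrix.ext fun a b => ?_
    refine congrArg (i (univMatrix a b) + ·) ?_
    refine TrivSqZeroExt.ext ?_ ?_ <;> simp [e, i]
  rw [hY] at hF
  have hcell : (Frame.cell univMatrix).map (TrivSqZeroExt.inlAlgHom K R R : R →+* R[ε]) =
      Frame.cell Y := Frame.cell_map _ _
  have key := s.2.2 (CommAlgCat.of K R[ε]) (Frame.cell (Matrix.of fun a b =>
      TrivSqZeroExt.inl (MvPolynomial.X (a, b)) + TrivSqZeroExt.inr (cellField X.1 a b))) h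
  rw [apply_cell, ← hF, ← hcell] at key
  have := congrArg TrivSqZeroExt.snd (key.trans (congrArg₂ (· * ·)
    (det_one_sub_eps_pow (cellGauge X.1) d)
    (aeval_inl_add_eps_smul (fun p => cellField X.1 p.1 p.2) (restrictCell s))))
  exact this.trans (snd_one_sub_inr_mul _ _ _)

end CellAction

/-! ### Polynomials acting as differential operators -/

section Pairing

variable {K : Type*} [Field K] {σ : Type*}

theorem coeff_X_mul_pderiv (p : σ) (f : MvPolynomial σ K) (a : σ →₀ ℕ) :
    (MvPolynomial.X p * MvPolynomial.pderiv p f).coeff a = a p * f.coeff a := by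
  classical
  rw [MvPolynomial.coeff_X_mul', MvPolynomial.coeff_pderiv]
  split_ifs with h
  · have hp : 1 ≤ a p := Nat.one_le_iff_ne_zero.2 (Finsupp.mem_support_iff.1 h)
    rw [Finsupp.sub_add_single_one_cancel (Finsupp.mem_support_iff.1 h), Finsupp.tsub_apply,
      Finsupp.single_eq_same, Nat.cast_sub hp]
    push_cast
    ring
  · rw [Finsupp.notMem_support_iff.1 h]
    simp

variable [Fintype σ]

theorem coeff_euler (f : MvPolynomial σ K) (a : σ →₀ ℕ) :
    (∑ p, MvPolynomial.X p * MvPolynomial.pderiv p f).coeff a = a.degree * f.coeff a := by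
  simp_rw [MvPolynomial.coeff_sum, coeff_X_mul_pderiv, ← Finset.sum_mul, Finsupp.degree_eq_sum,
    Nat.cast_sum]

/-- The pairing `⟨p, g⟩ = (p(∂) g)(0)`. -/
noncomputable def diffPairing : MvPolynomial σ K →ₗ[K] MvPolynomial σ K →ₗ[K] K :=
  (MvPolynomial.basisMonomials σ K).constr K
    fun a => ((∏ i, (a i).factorial : ℕ) : K) • MvPolynomial.lcoeff K a

theorem diffPairing_monomial (a : σ →₀ ℕ) (c : K) (g : MvPolynomial σ K) :
    diffPairing (MvPolynomial.monomial a c) g = c * ((∏ i, (a i).factorial : ℕ) * g.coeff a) := by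
  have h : MvPolynomial.monomial a c = c • MvPolynomial.basisMonomials σ K a := by
    simp [MvPolynomial.smul_monomial]
  rw [h, map_smul, diffPairing, Module.Basis.constr_basis]
  simp [MvPolynomial.lcoeff_apply]

theorem diffPairing_one (g : MvPolynomial σ K) :
    diffPairing 1 g = MvPolynomial.constantCoeff g := by
  rw [← MvPolynomial.C_1, MvPolynomial.C_apply, diffPairing_monomial]
  simp [MvPolynomial.constantCoeff_eq]

/-- Multiplication by a variable is adjoint to the derivative. On monomials this is `(a + e_i)! = a!
(a_i + 1)`. -/
theorem diffPairing_X_mul (i : σ) (p g : MvPolynomial σ K) :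
    diffPairing (MvPolynomial.X i * p) g = diffPairing p (MvPolynomial.pderiv i g) := by
  classical
  induction p using MvPolynomial.induction_on' with
  | add p q hp hq => simp only [mul_add, map_add, LinearMap.add_apply, hp, hq]
  | monomial a c =>
    rw [MvPolynomial.X, MvPolynomial.monomial_mul, one_mul, diffPairing_monomial,
      diffPairing_monomial, MvPolynomial.coeff_pderiv, add_comm (Finsupp.single i 1)]
    have : ∏ j, ((a + Finsupp.single i 1 : σ →₀ ℕ) j).factorial =
        (∏ j, (a j).factorial) * (a i + 1) := by
      rw [← Finset.mul_prod_erase _ _ (Finset.mem_univ i),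
        ← Finset.mul_prod_erase _ (fun j => (a j).factorial) (Finset.mem_univ i)]
      have h : ∀ j ∈ Finset.univ.erase i,
          ((a + Finsupp.single i 1 : σ →₀ ℕ) j).factorial = (a j).factorial := by
        intro j hj
        rw [Finsupp.add_apply, Finsupp.single_eq_of_ne (Finset.ne_of_mem_erase hj), add_zero]
      rw [Finset.prod_congr rfl h, Finsupp.add_apply, Finsupp.single_eq_same, Nat.factorial_succ]
      ring
    rw [this]
    push_cast
    ring

/-- Distinct monomials are orthogonal; in characteristic zero, pairing with a monomial therefore
recovers the corresponding coefficient of `p`. -/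
theorem diffPairing_monomial_right (p : MvPolynomial σ K) (a : σ →₀ ℕ) :
    diffPairing p (MvPolynomial.monomial a 1) = (∏ i, (a i).factorial : ℕ) * p.coeff a := by
  classical
  induction p using MvPolynomial.induction_on' with
  | add p q hp hq => rw [map_add, LinearMap.add_apply, hp, hq, MvPolynomial.coeff_add, mul_add]
  | monomial b c =>
    rw [diffPairing_monomial, MvPolynomial.coeff_monomial, MvPolynomial.coeff_monomial]
    by_cases h : a = b
    · subst h; simp [mul_comm]
    · simp [h, Ne.symm h]

end Pairing

/-! ### Enveloping algebras of abelian Lie algebras -/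

section Abelian

variable {K : Type*} [Field K] {L : Type*} [LieRing L] [LieAlgebra K L]

/-- The universal property lifts `ι`, with values in the subalgebra it generates, to a map on all of
`U(L)`. Followed by the inclusion it fixes every `ι X`, so it is the identity. -/
theorem adjoin_range_ι :
    Algebra.adjoin K (Set.range (UniversalEnvelopingAlgebra.ι K : L → _)) = ⊤ := by
  set S := Algebra.adjoin K (Set.range (UniversalEnvelopingAlgebra.ι K : L → _))
  let f : L →ₗ⁅K⁆ S :=
    { toFun := fun X => ⟨UniversalEnvelopingAlgebra.ι K X, Algebra.subset_adjoin ⟨X, rfl⟩⟩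
      map_add' := fun X Y => Subtype.ext (map_add (UniversalEnvelopingAlgebra.ι K) X Y)
      map_smul' := fun c X => Subtype.ext (map_smul (UniversalEnvelopingAlgebra.ι K) c X)
      map_lie' := fun {X Y} => Subtype.ext (LieHom.map_lie (UniversalEnvelopingAlgebra.ι K) X Y) }
  have h : S.val.comp (UniversalEnvelopingAlgebra.lift K f) = AlgHom.id K _ := by
    apply UniversalEnvelopingAlgebra.hom_ext
    ext X
    exact congrArg Subtype.val (UniversalEnvelopingAlgebra.lift_ι_apply K f X)
  refine eq_top_iff.2 fun x _ => ?_
  have := DFunLike.congr_fun h x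
  rw [AlgHom.id_apply] at this
  rw [← this]
  exact (UniversalEnvelopingAlgebra.lift K f x).2

variable [IsLieAbelian L]

theorem envelopingAlgebra_mul_comm (x y : UniversalEnvelopingAlgebra K L) : x * y = y * x := by
  have h (z : UniversalEnvelopingAlgebra K L) :
      z ∈ Algebra.adjoin K (Set.range (UniversalEnvelopingAlgebra.ι K : L → _)) := by
    rw [adjoin_range_ι]
    exact Algebra.mem_top
  refine Algebra.commute_of_mem_adjoin_of_forall_mem_commute (h y) ?_
  rintro _ ⟨Y, rfl⟩
  refine (Algebra.commute_of_mem_adjoin_of_forall_mem_commute (h x) ?_).symm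
  rintro _ ⟨X, rfl⟩
  have := LieHom.map_lie (UniversalEnvelopingAlgebra.ι K) Y X
  rw [trivial_lie_zero, map_zero, LieRing.of_associative_ring_bracket] at this
  exact sub_eq_zero.1 this.symm

variable {σ : Type*} [Fintype σ]

/-- The homomorphism from the enveloping algebra of an abelian Lie algebra to a polynomial ring
given by linear forms on the Lie algebra. -/
noncomputable def symbol (c : σ → L →ₗ[K] K) :
    UniversalEnvelopingAlgebra K L →ₐ[K] MvPolynomial σ K :=
  UniversalEnvelopingAlgebra.lift K
    { (∑ p, (c p).smulRight (MvPolynomial.X p : MvPolynomial σ K)) with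
      map_lie' := fun {X Y} => by
        rw [trivial_lie_zero, LieRing.of_associative_ring_bracket, mul_comm, sub_self]
        exact map_zero (∑ p, (c p).smulRight (MvPolynomial.X p : MvPolynomial σ K)) }

theorem symbol_ι (c : σ → L →ₗ[K] K) (X : L) :
    symbol c (UniversalEnvelopingAlgebra.ι K X) = ∑ p, c p X • MvPolynomial.X p := by
  rw [symbol, UniversalEnvelopingAlgebra.lift_ι_apply]
  change (∑ p, (c p).smulRight (MvPolynomial.X p : MvPolynomial σ K)) X = _
  simp

/-- A left inverse sends the variable `X p` to `ι (e p)`; it is defined because `U(L)` is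
commutative, and the composite is the identity because it fixes every `ι X`. -/
theorem symbol_injective (c : σ → L →ₗ[K] K) (e : σ → L) (h : ∀ X, ∑ p, c p X • e p = X) :
    Function.Injective (symbol c) := by
  let _ : CommRing (UniversalEnvelopingAlgebra K L) :=
    { (inferInstance : Ring (UniversalEnvelopingAlgebra K L)) with
      mul_comm := envelopingAlgebra_mul_comm }
  let ψ : MvPolynomial σ K →ₐ[K] UniversalEnvelopingAlgebra K L :=
    MvPolynomial.aeval fun p => UniversalEnvelopingAlgebra.ι K (e p)
  have hψ : ψ.comp (symbol c) = AlgHom.id K _ := by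
    apply UniversalEnvelopingAlgebra.hom_ext
    ext X
    change ψ (symbol c (UniversalEnvelopingAlgebra.ι K X)) = UniversalEnvelopingAlgebra.ι K X
    rw [symbol_ι, map_sum]
    conv_rhs => rw [← h X, map_sum]
    refine Finset.sum_congr rfl fun p _ => ?_
    rw [map_smul, map_smul]
    exact congrArg (c p X • ·) (MvPolynomial.aeval_X _ p)
  exact Function.LeftInverse.injective (g := ψ) (DFunLike.congr_fun hψ)

theorem totalDegree_symbol_le (c : σ → L →ₗ[K] K) {l : ℕ} {x : UniversalEnvelopingAlgebra K L}
    (hx : x ∈ envFiltration K L l) : (symbol c x).totalDegree ≤ l := by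
  suffices h : envFiltration K L l ≤
      (MvPolynomial.restrictTotalDegree σ K l).comap (symbol c).toLinearMap from
    (MvPolynomial.mem_restrictTotalDegree σ l _).1 (h hx)
  refine Submodule.span_le.2 ?_
  rintro _ ⟨xs, hl, rfl⟩
  refine (MvPolynomial.mem_restrictTotalDegree σ l _).2 (le_trans ?_ hl)
  clear hl
  rw [AlgHom.toLinearMap_apply]
  induction xs with
  | nil => simp
  | cons X xs ih =>
    rw [List.map_cons, List.prod_cons, map_mul, List.length_cons, add_comm]
    refine (MvPolynomial.totalDegree_mul _ _).trans (add_le_add ?_ ih)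
    rw [symbol_ι]
    refine MvPolynomial.totalDegree_finsetSum_le fun p _ =>
      (MvPolynomial.totalDegree_smul_le _ _).trans ?_
    simp

end Abelian

/-! ### Monomial sections -/

section Sections

variable {m n : ℕ}

namespace Frame

variable {R S : Type u} [CommRing R] [CommRing S]

/-- The minor of a frame on the rows obtained from the first `m` by replacing row `p.2` by
row `m + p.1`. -/
def minor (A : Frame m n R) (p : Fin n × Fin m) : R :=
  (A.top.updateRow p.2 (A.bot p.1)).det

/-- By Cramer's rule for the identity matrix. These minors extend the coordinates of the cell to
functions on all frames. -/
theorem minor_cell (Y : Matrix (Fin n) (Fin m) R) (p : Fin n × Fin m) :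
    (cell Y).minor p = Y p.1 p.2 := by
  rw [minor, top_cell, bot_cell, ← Matrix.cramer_transpose_apply, Matrix.transpose_one,
    Matrix.cramer_one]
  rfl

theorem minor_map (A : Frame m n R) (φ : R →+* S) (p : Fin n × Fin m) :
    (A.map φ).minor p = φ (A.minor p) := by
  rw [minor, minor, RingHom.map_det, RingHom.mapMatrix_apply, Matrix.map_updateRow]
  rfl

theorem minor_changeBasis (A : Frame m n R) (h : (Matrix (Fin m) (Fin m) R)ˣ)
    (p : Fin n × Fin m) :
    (A.changeBasis h).minor p = (h : Matrix (Fin m) (Fin m) R).det * A.minor p := by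
  rw [minor, minor, mul_comm, ← Matrix.det_mul, top_changeBasis, bot_changeBasis]
  congr 1
  ext i j
  by_cases hi : i = p.2
  · subst hi; simp [Matrix.mul_apply]
  · simp [Matrix.mul_apply, hi]

end Frame

variable {K : Type u} [Field K] {d : ℕ}

/-- The section of `O(d)` that restricts to the monomial with exponent `a` on the big cell. -/
noncomputable def monomialSection (a : Fin n × Fin m →₀ ℕ) (ha : a.degree ≤ d) : globalSections K m n d :=
  -- The power of the top minor is `1` on the cell and raises the weight in `det h` from `a.degree`
  -- to `d`; `ha` makes the natural subtraction exact.
  ⟨fun _ A => A.top.det ^ (d - a.degree) * ∏ p, A.minor p ^ a p, by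
    constructor
    · intro R S φ A
      have h : (A.map (φ : R →+* S)).top.det = (φ : R →+* S) A.top.det := by
        rw [RingHom.map_det, Frame.top_map]
        rfl
      simp only [Frame.minor_map, h, map_mul, map_pow, map_prod]
      rfl
    · intro R A h
      simp only [Frame.minor_changeBasis, Frame.top_changeBasis, Matrix.det_mul, mul_pow,
        Finset.prod_mul_distrib, Finset.prod_pow_eq_pow_sum, ← Finsupp.degree_eq_sum]
      rw [show (h : Matrix (Fin m) (Fin m) R).det ^ d =
        (h : Matrix (Fin m) (Fin m) R).det ^ (d - a.degree) *
          (h : Matrix (Fin m) (Fin m) R).det ^ a.degree by rw [← pow_add, Nat.sub_add_cancel ha]]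
      ring⟩

theorem restrictCell_monomialSection (a : Fin n × Fin m →₀ ℕ) (ha : a.degree ≤ d) :
    restrictCell (monomialSection (K := K) a ha) = MvPolynomial.monomial a 1 := by
  change (Frame.cell univMatrix).top.det ^ (d - a.degree) *
    ∏ p, (Frame.cell univMatrix).minor p ^ a p = _
  simp only [Frame.top_cell, Matrix.det_one, one_pow, one_mul, Frame.minor_cell]
  rw [MvPolynomial.monomial_eq, MvPolynomial.C_1, one_mul, Finsupp.prod_fintype _ _ (by simp)]
  rfl

end Sections

/-! ### Highest weight vectors in the dual of the space of sections -/

section HighestWeight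

variable {K : Type u} [Field K] {m n d : ℕ}

/-- The lower left entries of a matrix. -/
def lowerEntry (p : Fin n × Fin m) : slV K m n →ₗ[K] K where
  toFun X := X.1 (Fin.natAdd m p.1) (Fin.castAdd n p.2)
  map_add' _ _ := rfl
  map_smul' _ _ := rfl

theorem lowerEntry_apply (p : Fin n × Fin m) (X : slV K m n) :
    lowerEntry p X = X.1 (Fin.natAdd m p.1) (Fin.castAdd n p.2) := rfl

/-- `𝔫` acts by translations of the cell: the frame is not renormalised and the vector field is
constant. -/
theorem restrictCell_lie_of_mem_oppositeNilradical (X : slV K m n)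
    (hX : X ∈ oppositeNilradical K m n) (s : globalSections K m n d) :
    restrictCell ⁅X, s⁆ =
      -∑ p, lowerEntry p X • MvPolynomial.pderiv p (restrictCell s) := by
  have h0 (i j : Fin (m + n)) (h : ¬ (m ≤ i.val ∧ j.val < m)) : X.1 i j = 0 := by
    by_contra h'
    exact h (hX i j h')
  have hg : cellGauge X.1 = (0 : Matrix (Fin m) (Fin m) (CellRing m n K)) := by
    refine Matrix.ext fun i j => ?_
    simp [cellGauge, Matrix.mul_apply, h0]
  have hf (p : Fin n × Fin m) : cellField X.1 p.1 p.2 = -MvPolynomial.C (lowerEntry p X) := by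
    simp [cellField, hg, Matrix.mul_apply, h0, lowerEntry_apply, MvPolynomial.algebraMap_eq]
  rw [restrictCell_lie, hg]
  simp [hf, MvPolynomial.C_mul']

/-- If `X` stabilises the span of the first `m` basis vectors, its value on sections at the
origin of the big cell is the product with a scalar. -/
theorem constantCoeff_restrictCell_lie (X : slV K m n) (hX : ∀ p, lowerEntry p X = 0)
    (s : globalSections K m n d) :
    MvPolynomial.constantCoeff (restrictCell ⁅X, s⁆) =
      -(d * ∑ i : Fin m, X.1 (Fin.castAdd n i) (Fin.castAdd n i)) *
        MvPolynomial.constantCoeff (restrictCell s) := by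
  have hf (p : Fin n × Fin m) : MvPolynomial.constantCoeff (cellField X.1 p.1 p.2) = 0 := by
    have := hX p
    rw [lowerEntry_apply] at this
    simp [cellField, Matrix.mul_apply, this, univMatrix]
  have hg : MvPolynomial.constantCoeff (cellGauge (m := m) (n := n) X.1).trace =
      ∑ i : Fin m, X.1 (Fin.castAdd n i) (Fin.castAdd n i) := by
    simp [cellGauge, Matrix.mul_apply, univMatrix, Matrix.trace, MvPolynomial.algebraMap_eq]
  rw [restrictCell_lie]
  simp [hf, hg]

variable (K m n) in
/-- The generator `diag (n, …, n, -m, …, -m)` of the centre of the Levi subalgebra. -/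
def leviCentre : slV K m n :=
  ⟨Matrix.diagonal (Fin.addCases (fun _ => (n : K)) fun _ => -(m : K)), by
    rw [LieAlgebra.SpecialLinear.sl]
    simp [Matrix.trace, Fin.sum_univ_add, mul_comm]⟩

/-- The gauge matrix is the scalar `n`, of trace `m * n`, and the field is `n Y + m Y`, so up to a
shift the operator measures total degree. -/
theorem restrictCell_leviCentre_lie (s : globalSections K m n d) :
    restrictCell ⁅leviCentre K m n, s⁆ =
      ((m : K) + n) • ∑ p, MvPolynomial.X p * MvPolynomial.pderiv p (restrictCell s) -
        ((d : K) * (m * n)) • restrictCell s := by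
  have hg : cellGauge (leviCentre K m n).1 =
      Matrix.diagonal fun _ : Fin m => MvPolynomial.C (σ := Fin n × Fin m) (n : K) := by
    refine Matrix.ext fun i j => ?_
    have (i : Fin m) (k : Fin n) : Fin.castAdd n i ≠ Fin.natAdd m k := by
      simp [Fin.ext_iff]; omega
    by_cases h : i = j <;>
      simp [cellGauge, leviCentre, Matrix.mul_apply, h, this]
  have hf (p : Fin n × Fin m) : cellField (leviCentre K m n).1 p.1 p.2 =
      MvPolynomial.C ((m : K) + n) * MvPolynomial.X p := by
    have (k : Fin n) (i : Fin m) : Fin.natAdd m k ≠ Fin.castAdd n i := by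
      simp [Fin.ext_iff]; omega
    rw [cellField, hg]
    simp [Matrix.mul_apply, this, leviCentre, Matrix.diagonal_apply, univMatrix]
    ring
  rw [restrictCell_lie, hg]
  simp [hf, MvPolynomial.smul_eq_C_mul, mul_assoc, Finset.mul_sum]

variable {v : dualSections K m n d}

theorem IsHighestWeightVector.apply_leviCentre_lie (hv : IsHighestWeightVector v)
    (s : globalSections K m n d) :
    v ⁅leviCentre K m n, s⁆ = -((d : K) * (m * n)) * v s := by
  have h := hv.lie_diagonal (leviCentre K m n) fun i j h => by
    by_contra hij
    exact h (Matrix.diagonal_apply_ne _ hij)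
  have h' := DFunLike.congr_fun h s
  rw [Module.Dual.lie_apply, LinearMap.smul_apply, smul_eq_mul] at h'
  have h'' : ∑ i : Fin m, (leviCentre K m n).1 (Fin.castAdd n i) (Fin.castAdd n i) =
      (m : K) * n := by
    simp [leviCentre]
  rw [h''] at h'
  linear_combination -h'

variable [CharZero K]

/-- In degree `k` the operator `leviCentre` has eigenvalue `(m + n) k - d m n`, whereas composing
`v` with it multiplies `v` by `-d m n`; these differ for `k ≥ 1`. Homogeneous components are not
known to come from sections, so the top degree is removed by an operator that preserves sections, by
induction on `N`. -/
theorem IsHighestWeightVector.apply_eq_zero_of_degree (hv : IsHighestWeightVector v) (N : ℕ)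
    (s : globalSections K m n d)
    (hs : ∀ a, (restrictCell s).coeff a ≠ 0 → 1 ≤ a.degree ∧ a.degree ≤ N) : v s = 0 := by
  have eq_zero (t : globalSections K m n d) (ht : ∀ a, (restrictCell t).coeff a = 0) : v t = 0 := by
    have : restrictCell t = 0 := MvPolynomial.ext _ _ ht
    rw [restrictCell_injective (this.trans (map_zero _).symm), map_zero]
  -- If `m + n = 0` the eigenvalues coincide, but there are no variables and hence no monomial of
  -- positive degree.
  by_cases hmn : m + n = 0
  · refine eq_zero s fun a => ?_
    by_contra h
    obtain rfl : m = 0 := by omega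
    have : a = 0 := Finsupp.ext fun p => p.2.elim0
    have := (hs a h).1
    simp_all
  induction N generalizing s with
  | zero =>
    refine eq_zero s fun a => ?_
    by_contra h
    have := hs a h
    omega
  | succ N ih =>
    -- `leviCentre` minus its eigenvalue in degree `N + 1`, applied to `s`: this kills that degree
    -- and multiplies `v s` by `-(m + n) (N + 1)`.
    let t := ⁅leviCentre K m n, s⁆ + ((d : K) * (m * n) - (m + n) * (N + 1 : ℕ)) • s
    have ht (a) : (restrictCell t).coeff a =
        ((m : K) + n) * (a.degree - (N + 1 : ℕ)) * (restrictCell s).coeff a := by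
      simp only [t, map_add, map_smul, restrictCell_leviCentre_lie, MvPolynomial.coeff_add,
        MvPolynomial.coeff_sub, MvPolynomial.coeff_smul, coeff_euler, smul_eq_mul]
      ring
    have h0 : v t = 0 := by
      refine ih t fun a ha => ?_
      rw [ht] at ha
      have h1 := hs a (right_ne_zero_of_mul ha)
      have h2 : a.degree ≠ N + 1 := by
        intro h
        rw [h, sub_self, mul_zero, zero_mul] at ha
        exact ha rfl
      omega
    have h1 : ((m : K) + n) * (N + 1 : ℕ) * v s = 0 := by
      simp only [t, map_add, map_smul, hv.apply_leviCentre_lie, smul_eq_mul] at h0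
      linear_combination -h0
    refine (mul_eq_zero.1 h1).resolve_left ?_
    exact_mod_cast Nat.mul_ne_zero hmn N.succ_ne_zero

/-- A highest weight vector is a multiple of the evaluation at the origin of the big cell. -/
theorem IsHighestWeightVector.exists_eq_mul_constantCoeff (hv : IsHighestWeightVector v) :
    ∃ c : K, c ≠ 0 ∧ ∀ s, v s = c * MvPolynomial.constantCoeff (restrictCell s) := by
  -- `s₀` is the `d`-th power of the top minor, equal to `1` on the cell; subtracting a multiple of
  -- it removes the constant term of any section.
  let s₀ : globalSections K m n d := monomialSection 0 (by simp)
  have hs₀ : restrictCell s₀ = 1 := restrictCell_monomialSection _ _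
  have key (s) : v s = v s₀ * MvPolynomial.constantCoeff (restrictCell s) := by
    have h := hv.apply_eq_zero_of_degree (restrictCell s).totalDegree
      (s - MvPolynomial.constantCoeff (restrictCell s) • s₀) fun a ha => by
        rw [map_sub, map_smul, hs₀, MvPolynomial.coeff_sub, MvPolynomial.coeff_smul,
          MvPolynomial.coeff_one] at ha
        by_cases h0 : a = 0
        · subst h0
          simp [MvPolynomial.constantCoeff_eq] at ha
        · rw [if_neg (Ne.symm h0), smul_zero, sub_zero] at ha
          refine ⟨Nat.one_le_iff_ne_zero.2 fun h => h0 ((Finsupp.degree_eq_zero_iff a).1 h), ?_⟩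
          exact MvPolynomial.le_totalDegree (MvPolynomial.mem_support_iff.2 ha)
    rw [map_sub, map_smul, smul_eq_mul] at h
    linear_combination h
  refine ⟨v s₀, fun h => hv.ne_zero (LinearMap.ext fun s => ?_), key⟩
  rw [key, h, zero_mul, LinearMap.zero_apply]

end HighestWeight

/-! ### The action of the opposite nilradical on a highest weight vector -/

section OppositeNilradical

variable {K : Type u} [Field K] {m n d : ℕ}

instance oppositeNilradical.instIsLieAbelian : IsLieAbelian (oppositeNilradical K m n) := by
  have h (Z T : oppositeNilradical K m n) : Z.1.1 * T.1.1 = 0 := by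
    ext a b
    rw [Matrix.mul_apply, Matrix.zero_apply]
    refine Finset.sum_eq_zero fun k _ => ?_
    by_contra h0
    have h1 := Z.2 a k (left_ne_zero_of_mul h0)
    have h2 := T.2 k b (right_ne_zero_of_mul h0)
    omega
  refine ⟨fun X Y => Subtype.ext (Subtype.ext ?_)⟩
  change ⁅X.1, Y.1⁆.1 = 0
  rw [LieAlgebra.SpecialLinear.sl_bracket, h, h, sub_zero]

/-- The elementary matrices in the opposite nilradical. -/
def lowerUnit (p : Fin n × Fin m) : oppositeNilradical K m n :=
  ⟨⟨Matrix.single (Fin.natAdd m p.1) (Fin.castAdd n p.2) 1, by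
      rw [LieAlgebra.SpecialLinear.sl]
      have : Fin.natAdd m p.1 ≠ Fin.castAdd n p.2 := by simp [Fin.ext_iff]; omega
      simp [Matrix.trace_single_eq_of_ne _ _ _ this]⟩, by
    intro i j h
    have : Fin.natAdd m p.1 = i ∧ Fin.castAdd n p.2 = j := by
      by_contra h'
      exact h (Matrix.single_apply_of_ne _ _ _ _ _ h')
    obtain ⟨rfl, rfl⟩ := this
    simp⟩

/-- The sum is the projection of `𝔤` onto `𝔫`; it is used both to split `𝔤` and, on `𝔫` itself, as a
coordinate expansion. -/
theorem sum_lowerEntry_smul_lowerUnit_apply (X : slV K m n) (i j : Fin (m + n)) :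
    (∑ p, lowerEntry p X • lowerUnit p : oppositeNilradical K m n).1.1 i j =
      if m ≤ i.val ∧ j.val < m then X.1 i j else 0 := by
  have h : (∑ p, lowerEntry p X • lowerUnit p : oppositeNilradical K m n).1.1 =
      ∑ p : Fin n × Fin m, lowerEntry p X •
        Matrix.single (Fin.natAdd m p.1) (Fin.castAdd n p.2) (1 : K) := by
    simp [lowerUnit]
  rw [h, Matrix.sum_apply]
  split_ifs with hij
  · obtain ⟨i, rfl⟩ : ∃ k, Fin.natAdd m k = i :=
      ⟨⟨i - m, by omega⟩, Fin.ext (Nat.add_sub_cancel' hij.1)⟩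
    obtain ⟨j, rfl⟩ : ∃ k, Fin.castAdd n k = j := ⟨⟨j, hij.2⟩, rfl⟩
    rw [Finset.sum_eq_single (i, j)]
    · simp [lowerEntry_apply]
    · rintro ⟨a, b⟩ - hab
      rw [Matrix.smul_apply, Matrix.single_apply_of_ne, smul_zero]
      simpa [Prod.ext_iff] using hab
    · simp
  · refine Finset.sum_eq_zero fun p _ => ?_
    rw [Matrix.smul_apply, Matrix.single_apply_of_ne, smul_zero]
    rintro ⟨rfl, rfl⟩
    simp at hij

theorem sum_lowerEntry_smul_lowerUnit (X : oppositeNilradical K m n) :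
    ∑ p, lowerEntry p X.1 • lowerUnit p = X := by
  refine Subtype.ext (Subtype.ext (Matrix.ext fun i j => ?_))
  rw [sum_lowerEntry_smul_lowerUnit_apply]
  split_ifs with h
  · rfl
  · by_contra h'
    exact h (X.2 i j (Ne.symm h'))

/-- Split off the lower left block. The rest lies in `𝔭`, which fixes the origin of the cell, and
`v` is a multiple of evaluation there. This also covers the lower triangular part of the Levi
subalgebra, on which the definition of a highest weight vector says nothing directly. -/
theorem IsHighestWeightVector.exists_add_lie_eq_smul [CharZero K] {v : dualSections K m n d}
    (hv : IsHighestWeightVector v) (X : slV K m n) :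
    ∃ Y ∈ oppositeNilradical K m n, ∃ P : slV K m n, X = Y + P ∧ ∃ c : K, ⁅P, v⁆ = c • v := by
  let Y : oppositeNilradical K m n := ∑ p, lowerEntry p X • lowerUnit p
  refine ⟨Y, Y.2, X - Y, (add_sub_cancel _ _).symm,
    d * ∑ i : Fin m, (X - Y : slV K m n).1 (Fin.castAdd n i) (Fin.castAdd n i), ?_⟩
  have hP (p : Fin n × Fin m) : lowerEntry p (X - Y : slV K m n) = 0 := by
    rw [map_sub, sub_eq_zero]
    change _ = Y.1.1 _ _
    rw [sum_lowerEntry_smul_lowerUnit_apply, if_pos (by simp)]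
    rfl
  obtain ⟨c, -, hc⟩ := hv.exists_eq_mul_constantCoeff
  refine LinearMap.ext fun s => ?_
  rw [Module.Dual.lie_apply, hc, constantCoeff_restrictCell_lie _ hP, LinearMap.smul_apply, hc,
    smul_eq_mul]
  ring

/-- The sign of the dual action cancels the sign in the action of `𝔫` on sections, and
`diffPairing_X_mul` turns each derivative of `s` into a factor of the symbol. -/
theorem lift_envInclusion_apply {v : dualSections K m n d} {c : K}
    (hc : ∀ s, v s = c * MvPolynomial.constantCoeff (restrictCell s)) {l : ℕ}
    {x : UniversalEnvelopingAlgebra K (oppositeNilradical K m n)}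
    (hx : x ∈ envFiltration K (oppositeNilradical K m n) l) (s : globalSections K m n d) :
    UniversalEnvelopingAlgebra.lift K (LieModule.toEnd K (slV K m n) (dualSections K m n d))
        (envInclusion K (oppositeNilradical K m n) x) v s =
      c * diffPairing (symbol (fun p => (lowerEntry p).comp
        (oppositeNilradical K m n).subtype) x) (restrictCell s) := by
  induction hx using Submodule.span_induction with
  | mem x hx =>
    obtain ⟨xs, -, rfl⟩ := hx
    induction xs generalizing s with
    | nil => simp [hc, diffPairing_one]
    | cons X xs ih =>
      rw [List.map_cons, List.prod_cons, map_mul, map_mul, Module.End.mul_apply, envInclusion_ι,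
        UniversalEnvelopingAlgebra.lift_ι_apply, LieModule.toEnd_apply_apply,
        Module.Dual.lie_apply, ih, restrictCell_lie_of_mem_oppositeNilradical _ X.2, map_mul,
        symbol_ι, Finset.sum_mul, map_neg, map_sum, map_sum, LinearMap.sum_apply, mul_neg, neg_neg]
      congr 1
      refine Finset.sum_congr rfl fun p _ => ?_
      rw [smul_mul_assoc, map_smul, map_smul, LinearMap.smul_apply, diffPairing_X_mul]
      rfl
  | zero => simp
  | add x y _ _ hx hy => simp only [map_add, LinearMap.add_apply, hx, hy, mul_add]
  | smul a x _ hx =>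
    simp only [map_smul, LinearMap.smul_apply, hx, smul_eq_mul]
    ring

/-- A monomial `a` occurring in the symbol has degree at most `l ≤ d`, so it is the restriction of a
section. On that section `x v` takes the value `c * a!` times the coefficient of `a`, which is
nonzero. -/
theorem IsHighestWeightVector.eq_zero_of_lift_envInclusion_apply_eq_zero [CharZero K]
    {v : dualSections K m n d} (hv : IsHighestWeightVector v) {l : ℕ} (hl : l ≤ d)
    {x : UniversalEnvelopingAlgebra K (oppositeNilradical K m n)}
    (hx : x ∈ envFiltration K (oppositeNilradical K m n) l)
    (h : UniversalEnvelopingAlgebra.lift K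
      (LieModule.toEnd K (slV K m n) (dualSections K m n d))
        (envInclusion K (oppositeNilradical K m n) x) v = 0) : x = 0 := by
  obtain ⟨c, hc0, hc⟩ := hv.exists_eq_mul_constantCoeff
  have hinj := symbol_injective (fun p : Fin n × Fin m => (lowerEntry p).comp
    (oppositeNilradical K m n).subtype) lowerUnit sum_lowerEntry_smul_lowerUnit
  refine hinj ?_
  rw [map_zero]
  refine MvPolynomial.ext _ _ fun a => ?_
  rw [MvPolynomial.coeff_zero]
  by_contra ha
  have hal : a.degree ≤ d := (MvPolynomial.le_totalDegree (MvPolynomial.mem_support_iff.2 ha)).trans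
    ((totalDegree_symbol_le _ hx).trans hl)
  have h1 := lift_envInclusion_apply hc hx (monomialSection a hal)
  rw [h, LinearMap.zero_apply, restrictCell_monomialSection, diffPairing_monomial_right] at h1
  refine mul_ne_zero hc0 (mul_ne_zero ?_ ha) h1.symm
  exact Nat.cast_ne_zero.2 (Finset.prod_ne_zero_iff.2 fun i _ => Nat.factorial_ne_zero _)

end OppositeNilradical

end GrassmannianJets

theorem theorem4p8 {K : Type u} [Field K] [CharZero K] (m n d l : ℕ) (hl : 1 ≤ l) (hld : l < d)
    (v : GrassmannianJets.dualSections K m n d) (hv : GrassmannianJets.IsHighestWeightVector v) :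
    ∃ e : (GrassmannianJets.envFiltration K (GrassmannianJets.oppositeNilradical K m n) l ×
          GrassmannianJets.annFiltration K (L := GrassmannianJets.slV K m n) v l) ≃ₗ[K]
        GrassmannianJets.envFiltration K (GrassmannianJets.slV K m n) l,
      ∀ x y, (e (x, y) : UniversalEnvelopingAlgebra K (GrassmannianJets.slV K m n)) =
        GrassmannianJets.envInclusion K (GrassmannianJets.oppositeNilradical K m n)
          (x : UniversalEnvelopingAlgebra K (GrassmannianJets.oppositeNilradical K m n)) +
        (y : UniversalEnvelopingAlgebra K (GrassmannianJets.slV K m n)) :=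
  GrassmannianJets.exists_linearEquiv_envFiltration _ v l
    (GrassmannianJets.envFiltration_le_map_sup_annFiltration _ v hv.exists_add_lie_eq_smul l)
    fun _ hx h => hv.eq_zero_of_lift_envInclusion_apply_eq_zero hld.le hx h
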